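/- Let $V,H$ be complex Hilbert spaces with $V\hookrightarrow H$ (continuous injection with dense range), let $V'$ be the antidual of $V$, and regard $H\subset V'$ through $\langle x,v\rangle_{V',V}=\langle x,v\rangle_H$. Let $\mathcal E\colon V\times V\to\mathbb C$ be a continuous sesquilinear form which is coercive: there is $\mu>0$ with $\operatorname{Re}\mathcal E(u,u)\ge\mu\|u\|_V^2$ for all $u\in V$. Let $\mathcal A\in\mathcal L(V,V')$ be given by $\langle\mathcal Au,v\rangle_{V',V}=\mathcal E(u,v)$, and let $A$ be the part of $\mathcal A$ in $H$, i.e. $D(A)=\{x\in V:\mathcal Ax\in H\}$, $Ax=\mathcal Ax$. Let $0<s<1$. For $\theta\in(0,1)$ and a normed space $Y$ continuously embedded in a normed space $X$, let $W_\theta(X,Y)$ be the space of all $u\in L^1_{\rm loc}((0,\infty);Y)$ with weak derivative $u'\in L^1_{\rm loc}((0,\infty);X)$ such that $t^\theta u\in L^2((0,\infty);Y,\frac{dt}{t})$ and $t^\theta u'\in L^2((0,\infty);X,\frac{dt}{t})$. A function $u\in W_{1-s}(H,V)$ is called $s$-harmonic if $t^{1-2s}u'\in W_s(V',H)$ and $$-(t^{1-2s}u')'(t)+t^{1-2s}\mathcal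 Au(t)=0\ \text{ in } V' \text{ for a.e. } t\in(0,\infty).$$ Let $[H,V]_s$ be the complex interpolation space. The Dirichlet-to-Neumann operator $\mathcal D_s$ is defined on $x\in[H,V]_s$ by $\mathcal D_sx=-\lim_{t\downarrow0}t^{1-2s}u'(t)$ (limit in $V'$), where $u$ is the $s$-harmonic function with $u(0):=\lim_{t\downarrow0}u(t)=x$ (limit in $H$); the limits are those of the continuous representatives of $t^{1-2s}u'$ and $u$ with values in $V'$ and $H$. Let $D_s$ be the part of $\mathcal D_s$ in $H$, i.e. $D(D_s)=\{x\in[H,V]_s:\mathcal D_sx\in H\}$, $D_sx=\mathcal D_sx$. Let $A^{-s}=\frac{\sin\pi s}{\pi}\int_0^\infty\lambda^{-s}(\lambda+A)^{-1}\,d\lambda\in\mathcal L(H)$ and let $A^s=(A^{-s})^{-1}$ be the fractional power of $A$, with domain the range of $A^{-s}$. **Theorem.** One has $D_s=c_sA^s$ (equality of operators in $H$, including their domains), where $$c_s=2^{1-2s}\,\frac{\Gamma(1-s)}{\Gamma(s)}.$$ -/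

import Mathlib

open Set Filter Topology MeasureTheory
open scoped ContDiff ComplexConjugate

noncomputable section

namespace FracDtN

/-! ### Weighted Sobolev spaces on the half line -/

section Sobolev

variable {X Y : Type*} [NormedAddCommGroup X] [NormedSpace ℂ X]
  [NormedAddCommGroup Y] [NormedSpace ℂ Y]

/-- The measure `dt / t` on the open half line `(0, ∞)`. -/
def mulHaar : Measure ℝ :=
  (volume.restrict (Ioi (0 : ℝ))).withDensity (fun t => ENNReal.ofReal t⁻¹)

/-- `L¹_loc((0, ∞); X)`. -/
def MemL1Loc (u : ℝ → X) : Prop := LocallyIntegrableOn u (Ioi (0 : ℝ)) volume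

/-- `v` is the weak derivative of `u` on `(0, ∞)`: for every `φ ∈ C_c^∞((0, ∞))`,
`- ∫ φ' u = ∫ φ v`. -/
def IsWeakDeriv (u v : ℝ → X) : Prop :=
  MemL1Loc u ∧ MemL1Loc v ∧
    ∀ φ : ℝ → ℂ, ContDiff ℝ ∞ φ → HasCompactSupport φ → tsupport φ ⊆ Ioi (0 : ℝ) →
      -(∫ t in Ioi (0 : ℝ), deriv φ t • u t) = ∫ t in Ioi (0 : ℝ), φ t • v t

/-- `u` lies in `W_s(X, Y)` and `u'` is its weak derivative: `u ∈ L¹_loc(Y)`, `u' ∈ L¹_loc(X)`,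
`t^s u ∈ L²(Y, dt/t)` and `t^s u' ∈ L²(X, dt/t)`. Here `Y` is regarded as a subspace of `X`
through the embedding `j`. -/
structure IsWWithDeriv (j : Y →L[ℂ] X) (s : ℝ) (u : ℝ → Y) (u' : ℝ → X) : Prop where
  memL1Loc : MemL1Loc u
  isWeakDeriv : IsWeakDeriv (fun t => j (u t)) u'
  memLp : MemLp (fun t : ℝ => (t ^ s : ℝ) • u t) 2 mulHaar
  memLp_deriv : MemLp (fun t : ℝ => (t ^ s : ℝ) • u' t) 2 mulHaar

/-- `lim_{t ↓ 0} u(t) = x` in `X`. Elements of `W_s(X, Y)` are classes of functions modulo null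
sets, and the limit is that of the representative that is continuous on `(0, ∞)` with values
in `X`. -/
def HasTrace (j : Y →L[ℂ] X) (u : ℝ → Y) (x : X) : Prop :=
  ∃ v : ℝ → X, ContinuousOn v (Ioi (0 : ℝ)) ∧
    (∀ᵐ t ∂(volume.restrict (Ioi (0 : ℝ))), v t = j (u t)) ∧
    Tendsto v (𝓝[>] (0 : ℝ)) (𝓝 x)

/-- The complex interpolation space `[X, Y]_θ`, as a subset of `X`, for `Y` embedded in `X` by `j`:
the values at `θ` of the bounded continuous functions `f` on the closed strip `0 ≤ Re z ≤ 1` with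
values in `X = X + Y` that are holomorphic in the open strip and for which `t ↦ f (1 + i t)` is
bounded and continuous with values in `Y`. -/
def complexInterp (j : Y →L[ℂ] X) (θ : ℝ) : Set X :=
  {x | ∃ f : ℂ → X,
    ContinuousOn f {z : ℂ | 0 ≤ z.re ∧ z.re ≤ 1} ∧
    (∃ C : ℝ, ∀ z : ℂ, 0 ≤ z.re → z.re ≤ 1 → ‖f z‖ ≤ C) ∧
    DifferentiableOn ℂ f {z : ℂ | 0 < z.re ∧ z.re < 1} ∧
    (∃ g : ℝ → Y, Continuous g ∧ (∃ C : ℝ, ∀ t : ℝ, ‖g t‖ ≤ C) ∧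
      ∀ t : ℝ, f (1 + (t : ℂ) * Complex.I) = j (g t)) ∧
    f (θ : ℂ) = x}

end Sobolev

/-! ### Fractional powers -/

section FractionalPower

variable {H : Type*} [NormedAddCommGroup H] [NormedSpace ℂ H]

/-- `R` is the bounded everywhere defined inverse of `l + A`. -/
def IsShiftInverse (A : H →ₗ.[ℂ] H) (l : ℂ) (R : H →L[ℂ] H) : Prop :=
  ∀ x y : H, R y = x ↔ ∃ hx : x ∈ A.domain, l • x + A ⟨x, hx⟩ = y

open Classical in
/-- The operator `(l + A)⁻¹` (set to `0` if `l + A` has no bounded everywhere defined inverse). -/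
def shiftInverse (A : H →ₗ.[ℂ] H) (l : ℂ) : H →L[ℂ] H :=
  if h : ∃ R : H →L[ℂ] H, IsShiftInverse A l R then h.choose else 0

/-- The operator `(l + A)⁻¹` is unique. -/
theorem shiftInverse_eq {A : H →ₗ.[ℂ] H} {l : ℂ} {R : H →L[ℂ] H} (hR : IsShiftInverse A l R) :
    shiftInverse A l = R := by
  have h : ∃ R : H →L[ℂ] H, IsShiftInverse A l R := ⟨R, hR⟩
  ext y
  rw [shiftInverse, dif_pos h]
  exact (h.choose_spec _ _).2 ((hR _ _).1 rfl)

/-- `A^{-s} = (sin (π s) / π) ∫_0^∞ λ^{-s} (λ + A)⁻¹ dλ` for `0 < s < 1`. -/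
def negFracPow (A : H →ₗ.[ℂ] H) (s : ℝ) : H →L[ℂ] H :=
  (Real.sin (Real.pi * s) / Real.pi : ℝ) •
    ∫ l in Ioi (0 : ℝ), (l ^ (-s) : ℝ) • shiftInverse A (l : ℂ)

/-- The fractional power `A^s = (A^{-s})⁻¹`, with domain the range of `A^{-s}`. -/
def fracPow (A : H →ₗ.[ℂ] H) (s : ℝ) : H →ₗ.[ℂ] H :=
  ((negFracPow A s : H →ₗ[ℂ] H).toPMap ⊤).inverse

end FractionalPower

/-! ### Forms, the associated operator, harmonic functions, the Dirichlet-to-Neumann operator -/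

section Form

variable {V H : Type*} [NormedAddCommGroup V] [InnerProductSpace ℂ V]
  [NormedAddCommGroup H] [InnerProductSpace ℂ H]

/-- The embedding `H ↪ V'` of the Gelfand triple, `V'` being the antidual of `V`:
`x ↦ (v ↦ ⟨x, v⟩_H)`, where `⟨·, ·⟩_H` is linear in its first argument. -/
def gelfand (i : V →L[ℂ] H) : H →L[ℂ] (V →L⋆[ℂ] ℂ) :=
  LinearMap.mkContinuous₂
    (LinearMap.mk₂'ₛₗ (RingHom.id ℂ) (starRingEnd ℂ)
      (fun (x : H) (v : V) => inner ℂ (i v) x)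
      (fun x y v => inner_add_right _ _ _)
      (fun c x v => by simp)
      (fun x v w => by simp)
      (fun c x v => by simp [mul_comm]))
    ‖i‖ (fun x v => by
      calc ‖inner ℂ (i v) x‖ ≤ ‖i v‖ * ‖x‖ := norm_inner_le_norm _ _
        _ ≤ (‖i‖ * ‖v‖) * ‖x‖ := by gcongr; exact i.le_opNorm v
        _ = ‖i‖ * ‖x‖ * ‖v‖ := by ring)

theorem gelfand_apply (i : V →L[ℂ] H) (x : H) (v : V) : gelfand i x v = inner ℂ (i v) x := rfl

/-- The graph of the part in `H` of the operator `𝒜 : V → V'`, `⟨𝒜 u, v⟩ = E u v`. -/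
def formGraph (i : V →L[ℂ] H) (E : V →L[ℂ] V →L⋆[ℂ] ℂ) : Submodule ℂ (H × H) where
  carrier := {p | ∃ v : V, i v = p.1 ∧ E v = gelfand i p.2}
  add_mem' := by
    rintro p q ⟨v, hv, hv'⟩ ⟨w, hw, hw'⟩
    exact ⟨v + w, by simp [hv, hw], by simp [hv', hw']⟩
  zero_mem' := ⟨0, by simp, by simp⟩
  smul_mem' := by
    rintro c p ⟨v, hv, hv'⟩
    exact ⟨c • v, by simp [hv], by simp [hv']⟩

/-- The operator `A` associated with the form `E`: the part of `𝒜` in `H`. -/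
def formOp (i : V →L[ℂ] H) (E : V →L[ℂ] V →L⋆[ℂ] ℂ) : H →ₗ.[ℂ] H :=
  (formGraph i E).toLinearPMap

/-- If `V` is embedded densely in `H`, the graph of `A` is the expected one. -/
theorem formOp_graph (i : V →L[ℂ] H) (E : V →L[ℂ] V →L⋆[ℂ] ℂ)
    (hi : Function.Injective i) (hd : DenseRange i) :
    (formOp i E).graph = formGraph i E := by
  refine Submodule.toLinearPMap_graph_eq _ ?_
  rintro ⟨x, y⟩ ⟨v, hv, hv'⟩ hx
  simp only at hv hv' hx ⊢
  have hv0 : v = 0 := hi (by rw [hv, hx, map_zero])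
  refine hd.eq_zero_of_inner_right ℂ (fun w => ?_)
  rw [← gelfand_apply, ← hv', hv0]
  simp

/-- `u` is `(E, s)`-harmonic with weak derivative `u'`: `u ∈ W_{1-s}(H, V)`,
`t^{1-2s} u' ∈ W_s(V', H)`, and `-(t^{1-2s} u')' + t^{1-2s} 𝒜 u = 0` in `V'` for almost every
`t > 0`. -/
def IsHarmonic (i : V →L[ℂ] H) (E : V →L[ℂ] V →L⋆[ℂ] ℂ) (s : ℝ) (u : ℝ → V) (u' : ℝ → H) : Prop :=
  IsWWithDeriv i (1 - s) u u' ∧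
  ∃ w' : ℝ → (V →L⋆[ℂ] ℂ),
    IsWWithDeriv (gelfand i) s (fun t : ℝ => (t ^ (1 - 2 * s) : ℝ) • u' t) w' ∧
    ∀ᵐ t : ℝ ∂(volume.restrict (Ioi (0 : ℝ))), -w' t + (t ^ (1 - 2 * s) : ℝ) • E (u t) = 0

/-- The graph in `H × V'` of the Dirichlet-to-Neumann operator `𝒟_s` with domain `[H, V]_s`:
`𝒟_s x = y` if there is an `s`-harmonic `u` with `u(0) = x` and
`y = -lim_{t ↓ 0} t^{1-2s} u'(t)` in `V'`. -/
def dtnGraph (i : V →L[ℂ] H) (E : V →L[ℂ] V →L⋆[ℂ] ℂ) (s : ℝ) : Set (H × (V →L⋆[ℂ] ℂ)) :=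
  {p | p.1 ∈ complexInterp i s ∧
    ∃ (u : ℝ → V) (u' : ℝ → H), IsHarmonic i E s u u' ∧ HasTrace i u p.1 ∧
      HasTrace (gelfand i) (fun t : ℝ => (t ^ (1 - 2 * s) : ℝ) • u' t) (-p.2)}

/-- The graph in `H × H` of the part `D_s` of `𝒟_s` in `H`. -/
def dtnPartGraph (i : V →L[ℂ] H) (E : V →L[ℂ] V →L⋆[ℂ] ℂ) (s : ℝ) : Set (H × H) :=
  {p | (p.1, gelfand i p.2) ∈ dtnGraph i E s}

end Form

/-- `c_s = 2^{1-2s} Γ(1-s) / Γ(s)`. -/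
def dtnConst (s : ℝ) : ℝ :=
  (2 : ℝ) ^ (1 - 2 * s) * (Real.Gamma (1 - s) / Real.Gamma s)

end FracDtN

end

/-!
The proof identifies `D_s` through its inverse: if `u` is `s`-harmonic with `u(0) = x` and
`-lim t^{1-2s} u'(t) = z ∈ H`, then `A^{-s} z = c_s x`.

*The identity.* Testing the equation for `u` with Gaussians shows that the rescaled averages
`g(r) = r^{s-1} ∫ t^{1-2s} e^{-t²/(4r)} u(t) dt` (`heatAvg`) solve the backward equation
`g' = 𝒜 g - r^{s-1} z` in `V'` (`IsSolution.heatAvg_ode`). So does the Laplace transform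
`h(r) = Γ(1-s)⁻¹ ∫ l^{-s} e^{-rl} (l + A)⁻¹ z dl` (`resolventAvg_ode`). The difference `w = g - h`
solves `w' = 𝒜 w`; by coercivity its norm in `H` grows exponentially unless it vanishes, whereas
`g` and `h` grow at most linearly. Hence `g = h` (`eq_zero_of_backward`). As `r ↓ 0`, the averages
`g(r)` concentrate at the initial value and tend to `2^{1-2s} Γ(1-s) x`, while `h(r)` tends to
`Γ(1-s)⁻¹ ∫ l^{-s} (l + A)⁻¹ z dl = Γ(s) A^{-s} z`; the last equality is the reflection formula for
the Gamma function. This gives `IsSolution.negFracPow_eq`. No semigroup and no functional calculus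
is needed: `(l + A)⁻¹` comes from the Lax--Milgram theorem, as an operator from `H` to `V`.

*Existence.* The Neumann problem with datum `z` is solved by Lax--Milgram on the Hilbert space
`W_{1-s}(H, V)`, realised as a closed subspace of pairs of square integrable functions. Its solution
is `s`-harmonic with conormal derivative `z`. Testing it with itself shows that `u(0) = 0` forces
`z = 0` (`exists_isHarmonic`), so that `A^{-s}` is injective and `A^s` is its honest inverse.

*Domains.* The range of `A^{-s}` lies in `[H, V]_s` because `A^{-s} y` is the value at `s` of a
multiple of the holomorphic function `z ↦ ∫ l^{-(z+s)/2} (l + A)⁻¹ y dl` on the unit strip. On the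
line `Re z = 1` this integral converges in `V`, as the norm of `(l + A)⁻¹` from `H` to `V` is
`O(l^{-1/2})` (`negFracPow_mem_complexInterp`). Together with the identity this shows that the graph
of `D_s` is the set of all `(A^{-s} y, c_s y)` with `y ∈ H`.
-/

noncomputable section

namespace FracDtN

local notation "ν₊" => (volume.restrict (Ioi (0 : ℝ)) : Measure ℝ)

/-! ### Weighted square integrable functions on the half line -/

section HalfLine

variable {X : Type*} [NormedAddCommGroup X] [NormedSpace ℂ X]

theorem ae_pos : ∀ᵐ t ∂ν₊, (0 : ℝ) < t := ae_restrict_mem measurableSet_Ioi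

theorem aestronglyMeasurable_rpow_smul_iff {g : ℝ → X} {b : ℝ} :
    AEStronglyMeasurable (fun t : ℝ => (t ^ b : ℝ) • g t) ν₊ ↔ AEStronglyMeasurable g ν₊ := by
  have hm (b : ℝ) : AEStronglyMeasurable (fun t : ℝ => t ^ b) ν₊ :=
    (by fun_prop : Measurable fun t : ℝ => t ^ b).aestronglyMeasurable
  refine ⟨fun h => ?_, fun h => (hm b).smul h⟩
  refine ((hm (-b)).smul h).congr ?_
  filter_upwards [ae_pos] with t ht
  simp only [Pi.smul_apply', smul_smul, ← Real.rpow_add ht]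
  simp

/-- The weight `t ^ a` with respect to `dt / t` is the weight `t ^ (a - 1 / 2)` with respect to
`dt`. -/
theorem memLp_mulHaar_iff {a : ℝ} {f : ℝ → X} :
    MemLp (fun t : ℝ => (t ^ a : ℝ) • f t) 2 mulHaar ↔
      MemLp (fun t : ℝ => (t ^ (a - 1 / 2) : ℝ) • f t) 2 ν₊ := by
  have hd : Measurable fun t : ℝ => ENNReal.ofReal t⁻¹ := by fun_prop
  have hac : mulHaar ≪ ν₊ := withDensity_absolutelyContinuous _ _
  have hac' : ν₊ ≪ mulHaar := by
    refine withDensity_absolutelyContinuous' hd.aemeasurable ?_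
    filter_upwards [ae_pos] with t ht
    simpa using ht
  have key (h : AEStronglyMeasurable f ν₊) : MemLp (fun t : ℝ => (t ^ a : ℝ) • f t) 2 mulHaar ↔
      MemLp (fun t : ℝ => (t ^ (a - 1 / 2) : ℝ) • f t) 2 ν₊ := by
    rw [memLp_two_iff_integrable_sq_norm ((aestronglyMeasurable_rpow_smul_iff.2 h).mono_ac hac),
      memLp_two_iff_integrable_sq_norm (aestronglyMeasurable_rpow_smul_iff.2 h), mulHaar,
      integrable_withDensity_iff hd (by simp)]
    refine integrable_congr ?_
    filter_upwards [ae_pos] with t ht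
    simp only [norm_smul, mul_pow, Real.norm_eq_abs, sq_abs]
    have e : (t ^ (a - 1 / 2)) ^ 2 = (t ^ a) ^ 2 * t⁻¹ := by
      rw [← Real.rpow_mul_natCast ht.le, ← Real.rpow_mul_natCast ht.le, ← Real.rpow_neg_one,
        ← Real.rpow_add ht]
      congr 1
      push_cast
      ring
    rw [ENNReal.toReal_ofReal (by positivity), e]
    ring
  constructor
  · intro h
    exact (key (aestronglyMeasurable_rpow_smul_iff.1 (h.1.mono_ac hac'))).1 h
  · intro h
    exact (key (aestronglyMeasurable_rpow_smul_iff.1 h.1)).2 h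

/-- Cauchy--Schwarz for dual weights `t ^ a` and `t ^ (-a)`. -/
theorem integrable_smul_of_memLp {𝕜 : Type*} [RCLike 𝕜] [NormedSpace 𝕜 X] {a : ℝ} {f : ℝ → X}
    {k : ℝ → 𝕜} (hf : MemLp (fun t : ℝ => (t ^ a : ℝ) • f t) 2 ν₊)
    (hk : MemLp (fun t : ℝ => ((t ^ (-a) : ℝ) : 𝕜) * k t) 2 ν₊) :
    Integrable (fun t => k t • f t) ν₊ := by
  have h : MemLp (fun t : ℝ => (((t ^ (-a) : ℝ) : 𝕜) * k t) • ((t ^ a : ℝ) • f t)) 1 ν₊ :=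
    hf.smul hk
  have h1 := (memLp_one_iff_integrable.1 h).norm
  have hf' : AEStronglyMeasurable f ν₊ := aestronglyMeasurable_rpow_smul_iff.1 hf.1
  have hk' : AEStronglyMeasurable k ν₊ := by
    have : AEStronglyMeasurable
        (fun t : ℝ => ((t ^ a : ℝ) : 𝕜) * (((t ^ (-a) : ℝ) : 𝕜) * k t)) ν₊ :=
      (RCLike.measurable_ofReal.comp
        (by fun_prop : Measurable fun t : ℝ => t ^ a)).aestronglyMeasurable.mul hk.1
    refine this.congr ?_
    filter_upwards [ae_pos] with t ht
    rw [← mul_assoc, ← RCLike.ofReal_mul, ← Real.rpow_add ht]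
    simp
  refine h1.mono' (hk'.smul hf') ?_
  filter_upwards [ae_pos] with t ht
  refine le_of_eq ?_
  rw [norm_smul, norm_smul, norm_smul, norm_mul, RCLike.norm_ofReal, Real.norm_eq_abs,
    Real.rpow_neg ht.le, abs_inv]
  have : |t ^ a| ≠ 0 := by positivity
  field_simp

/-- `f` is integrable near `0`, and the primitive of `‖f‖` vanishing at `0` is at most `C t ^ γ`.
This quantitative form is what justifies integration by parts against rapidly decreasing functions
on the whole half line. -/
structure PrimitiveBound (f : ℝ → X) (γ C : ℝ) : Prop where
  aesm : AEStronglyMeasurable f ν₊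
  integrableOn : ∀ t : ℝ, IntegrableOn f (Ioc 0 t)
  le : ∀ t : ℝ, 0 < t → ∫ τ in Ioc 0 t, ‖f τ‖ ≤ C * t ^ γ

theorem PrimitiveBound.norm_le {f : ℝ → X} {γ C : ℝ} (h : PrimitiveBound f γ C) {t : ℝ}
    (ht : 0 < t) : ‖∫ τ in Ioc 0 t, f τ‖ ≤ C * t ^ γ :=
  (norm_integral_le_integral_norm _).trans (h.le t ht)

/-- Cauchy--Schwarz: a function in a weighted `L²` space on the half line has a primitive
vanishing at `0`, of controlled growth. -/
theorem exists_primitiveBound {a : ℝ} (ha : a < 1 / 2) {f : ℝ → X}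
    (hf : MemLp (fun t : ℝ => (t ^ a : ℝ) • f t) 2 ν₊) :
    ∃ C, 0 ≤ C ∧ PrimitiveBound f (1 / 2 - a) C := by
  have hf' : AEStronglyMeasurable f ν₊ := aestronglyMeasurable_rpow_smul_iff.1 hf.1
  have hsub (t : ℝ) : (volume.restrict (Ioc 0 t) : Measure ℝ) ≤ ν₊ :=
    Measure.restrict_mono Ioc_subset_Ioi_self le_rfl
  have hpow (t : ℝ) : IntegrableOn (fun τ : ℝ => τ ^ (-(2 * a))) (Ioc 0 t) := by
    rcases le_or_gt t 0 with ht | ht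
    · simp [Ioc_eq_empty_of_le ht]
    · exact (intervalIntegrable_iff_integrableOn_Ioc_of_le ht.le).1
        (intervalIntegral.intervalIntegrable_rpow' (by linarith))
  have hk (t : ℝ) : MemLp (fun τ : ℝ => τ ^ (-a)) 2 (volume.restrict (Ioc 0 t)) := by
    rw [memLp_two_iff_integrable_sq
      (by fun_prop : Measurable fun t : ℝ => t ^ (-a)).aestronglyMeasurable]
    refine (hpow t).congr ?_
    filter_upwards [ae_restrict_mem measurableSet_Ioc] with τ hτ
    rw [← Real.rpow_natCast, ← Real.rpow_mul hτ.1.le]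
    congr 1
    push_cast
    ring
  set N : ℝ := (∫ τ in Ioi (0 : ℝ), ‖(τ ^ a : ℝ) • f τ‖ ^ (2 : ℝ)) ^ (1 / 2 : ℝ) with hN
  set D : ℝ := (1 / (1 - 2 * a)) ^ (1 / 2 : ℝ) with hD
  have h12 : 0 < 1 - 2 * a := by linarith
  refine ⟨D * N, by positivity, hf', fun t => ?_, fun t ht => ?_⟩
  · have h : MemLp (fun τ : ℝ => (τ ^ (-a) : ℝ) • (τ ^ a : ℝ) • f τ) 1
        (volume.restrict (Ioc 0 t)) :=
      MemLp.smul (𝕜 := ℝ) (hf.mono_measure (hsub t)) (hk t)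
    refine (memLp_one_iff_integrable.1 h).congr ?_
    filter_upwards [ae_restrict_mem measurableSet_Ioc] with τ hτ
    rw [smul_smul, ← Real.rpow_add hτ.1]
    simp
  · have hn : MemLp (fun τ : ℝ => ‖(τ ^ a : ℝ) • f τ‖) (ENNReal.ofReal 2)
        (volume.restrict (Ioc 0 t)) := by
      simpa using (hf.mono_measure (hsub t)).norm
    have h := integral_mul_le_Lp_mul_Lq_of_nonneg (μ := volume.restrict (Ioc 0 t))
      Real.HolderConjugate.two_two
      (f := fun τ : ℝ => τ ^ (-a)) (g := fun τ : ℝ => ‖(τ ^ a : ℝ) • f τ‖)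
      (by filter_upwards [ae_restrict_mem measurableSet_Ioc] with τ hτ
          exact Real.rpow_nonneg hτ.1.le _)
      (by filter_upwards with τ; positivity)
      (by simpa using hk t) hn
    have e1 : ∫ τ in Ioc 0 t, ‖f τ‖ = ∫ τ in Ioc 0 t, τ ^ (-a) * ‖(τ ^ a : ℝ) • f τ‖ := by
      refine setIntegral_congr_fun measurableSet_Ioc fun τ hτ => ?_
      have h0 : 0 < τ := hτ.1
      rw [norm_smul, Real.norm_of_nonneg (Real.rpow_nonneg h0.le _), ← mul_assoc,
        ← Real.rpow_add h0]
      simp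
    have e2 : ∫ τ in Ioc 0 t, (τ ^ (-a)) ^ (2 : ℝ) = 1 / (1 - 2 * a) * t ^ (1 - 2 * a) := by
      have : ∫ τ in Ioc 0 t, (τ ^ (-a)) ^ (2 : ℝ) = ∫ τ in Ioc 0 t, τ ^ (-(2 * a)) := by
        refine setIntegral_congr_fun measurableSet_Ioc fun τ hτ => ?_
        rw [← Real.rpow_mul hτ.1.le]
        congr 1
        ring
      rw [this, ← intervalIntegral.integral_of_le ht.le, integral_rpow (Or.inl (by linarith)),
        Real.zero_rpow (by linarith)]
      rw [show -(2 * a) + 1 = 1 - 2 * a by ring]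
      ring
    have e3 : (∫ τ in Ioc 0 t, ‖(τ ^ a : ℝ) • f τ‖ ^ (2 : ℝ)) ^ (1 / 2 : ℝ) ≤ N := by
      rw [hN]
      gcongr
      · filter_upwards with τ; positivity
      · have := (memLp_two_iff_integrable_sq_norm hf.1).1 hf
        simpa [IntegrableOn] using this
      · exact Ioc_subset_Ioi_self
    rw [e1]
    refine h.trans ?_
    rw [e2, Real.mul_rpow (by positivity) (by positivity), ← Real.rpow_mul ht.le]
    rw [show (1 - 2 * a) * (1 / 2) = 1 / 2 - a by ring]
    calc _ ≤ (1 / (1 - 2 * a)) ^ (1 / 2 : ℝ) * t ^ (1 / 2 - a) * N := by gcongr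
      _ = _ := by rw [hD]; ring

theorem integral_Ioi_indicator_Iic {Y : Type*} [NormedAddCommGroup Y] [NormedSpace ℝ Y] (t : ℝ)
    (g : ℝ → Y) : ∫ τ in Ioi (0 : ℝ), (Iic t).indicator g τ = ∫ τ in Ioc 0 t, g τ := by
  rw [integral_indicator measurableSet_Iic, Measure.restrict_restrict measurableSet_Iic,
    Iic_inter_Ioi]

/-- Integration by parts on the half line against the primitive of an integrable function. -/
theorem integral_deriv_smul_primitive {𝕜 : Type*} [RCLike 𝕜] [NormedSpace 𝕜 X] [CompleteSpace X]
    {ψ ψ' : ℝ → 𝕜} {f : ℝ → X} {γ C : ℝ}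
    (hψ : ∀ t : ℝ, 0 < t → HasDerivAt ψ (ψ' t) t) (hψt : Tendsto ψ atTop (𝓝 0))
    (hψi : IntegrableOn ψ' (Ioi 0)) (hψγ : IntegrableOn (fun t : ℝ => t ^ γ * ‖ψ' t‖) (Ioi 0))
    (hf : PrimitiveBound f γ C) :
    ∫ t in Ioi (0 : ℝ), ψ' t • ∫ τ in Ioc 0 t, f τ = -∫ t in Ioi (0 : ℝ), ψ t • f t := by
  have hS : MeasurableSet {p : ℝ × ℝ | p.2 ≤ p.1} := measurableSet_le measurable_snd measurable_fst
  -- Fubini on the region `τ ≤ t`.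
  set G : ℝ → ℝ → X := fun t τ => (Iic t).indicator (fun τ => ψ' t • f τ) τ with hG
  have hGm : AEStronglyMeasurable (Function.uncurry G) ((ν₊).prod ν₊) := by
    have : AEStronglyMeasurable (fun p : ℝ × ℝ => ψ' p.1 • f p.2) ((ν₊).prod ν₊) :=
      hψi.1.comp_fst.smul hf.aesm.comp_snd
    refine (this.indicator hS).congr (Eventually.of_forall fun p => ?_)
    simp [hG, Function.uncurry, indicator]
  have hGt (t : ℝ) : Integrable (G t) ν₊ := by
    rw [hG, integrable_indicator_iff measurableSet_Iic, IntegrableOn,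
      Measure.restrict_restrict measurableSet_Iic, Iic_inter_Ioi]
    exact (hf.integrableOn t).smul (ψ' t)
  have hGi : Integrable (Function.uncurry G) ((ν₊).prod ν₊) := by
    rw [integrable_prod_iff hGm]
    refine ⟨Eventually.of_forall hGt, (hψγ.const_mul C).mono' hGm.norm.integral_prod_right' ?_⟩
    filter_upwards [ae_pos] with t ht
    have : ∫ τ in Ioi (0 : ℝ), ‖G t τ‖ = ‖ψ' t‖ * ∫ τ in Ioc 0 t, ‖f τ‖ := by
      simp only [hG, norm_indicator_eq_indicator_norm]
      rw [integral_Ioi_indicator_Iic, ← integral_const_mul]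
      simp [norm_smul]
    simp only [Function.uncurry]
    rw [this, Real.norm_of_nonneg (by positivity)]
    calc _ ≤ ‖ψ' t‖ * (C * t ^ γ) := by gcongr; exact hf.le t ht
      _ = _ := by ring
  have h1 : ∫ t in Ioi (0 : ℝ), ψ' t • ∫ τ in Ioc 0 t, f τ
      = ∫ t in Ioi (0 : ℝ), ∫ τ in Ioi (0 : ℝ), G t τ := by
    congr 1
    ext t
    simp only [hG]
    rw [integral_Ioi_indicator_Iic, integral_smul]
  have h2 (τ : ℝ) (hτ : τ ∈ Ioi (0 : ℝ)) : ∫ t in Ioi (0 : ℝ), G t τ = -(ψ τ • f τ) := by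
    have e : (fun t => G t τ) = (Ici τ).indicator (fun t => ψ' t • f τ) := by
      ext t
      simp [hG, indicator]
    rw [e, integral_indicator measurableSet_Ici, Measure.restrict_restrict measurableSet_Ici,
      inter_eq_left.2 (Ici_subset_Ioi.2 hτ), integral_smul_const, integral_Ici_eq_integral_Ioi,
      integral_Ioi_of_hasDerivAt_of_tendsto' (fun t ht => hψ t (lt_of_lt_of_le hτ ht))
        (hψi.mono_set (Ioi_subset_Ioi (le_of_lt hτ))) hψt]
    simp
  rw [h1, integral_integral_swap hGi, setIntegral_congr_fun measurableSet_Ioi h2, integral_neg]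

end HalfLine

/-! ### Weak derivatives and traces -/

section WeakDerivative

variable {X : Type*} [NormedAddCommGroup X]

theorem MemL1Loc.integrable_smul {𝕜 : Type*} [RCLike 𝕜] [NormedSpace 𝕜 X] {f : ℝ → X} {φ : ℝ → 𝕜}
    (hf : MemL1Loc f) (hφ : Continuous φ) (hc : HasCompactSupport φ)
    (hs : tsupport φ ⊆ Ioi (0 : ℝ)) : Integrable (fun t => φ t • f t) volume := by
  have h : IntegrableOn (fun t => φ t • f t) (tsupport φ) :=
    (hf.integrableOn_compact_subset hs hc).continuousOn_smul hφ.continuousOn hc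
  refine (integrableOn_iff_integrable_of_support_subset ?_).1 h
  exact (Function.support_smul_subset_left φ f).trans (subset_tsupport φ)

variable [NormedSpace ℂ X]

theorem PrimitiveBound.continuousOn {f : ℝ → X} {γ C : ℝ} (hf : PrimitiveBound f γ C) :
    ContinuousOn (fun t => ∫ τ in Ioc 0 t, f τ) (Ici 0) := by
  intro t ht
  have h : IntegrableOn f (Icc 0 (t + 1)) :=
    (integrableOn_Icc_iff_integrableOn_Ioc).2 (hf.integrableOn (t + 1))
  have h1 := intervalIntegral.continuousOn_primitive h t ⟨ht, by linarith⟩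
  refine h1.mono_of_mem_nhdsWithin ?_
  rw [← Ici_inter_Iic]
  exact inter_mem_nhdsWithin _ (Iic_mem_nhds (by linarith))

theorem PrimitiveBound.tendsto {f : ℝ → X} {γ C : ℝ} (hf : PrimitiveBound f γ C) (x : X) :
    Tendsto (fun t => x + ∫ τ in Ioc 0 t, f τ) (𝓝[>] (0 : ℝ)) (𝓝 x) := by
  have h := (hf.continuousOn 0 self_mem_Ici).tendsto
  simp only [Ioc_self, setIntegral_empty] at h
  simpa using (h.mono_left (nhdsWithin_mono _ Ioi_subset_Ici_self)).const_add x

theorem setIntegral_Ioi_eq_integral_of_tsupport {Y : Type*} [NormedAddCommGroup Y] [NormedSpace ℝ Y]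
    {𝕜 : Type*} [RCLike 𝕜] [NormedSpace 𝕜 Y] {φ : ℝ → 𝕜} (hs : tsupport φ ⊆ Ioi (0 : ℝ))
    (f : ℝ → Y) : ∫ t in Ioi (0 : ℝ), φ t • f t = ∫ t, φ t • f t := by
  refine setIntegral_eq_integral_of_forall_compl_eq_zero fun t ht => ?_
  rw [image_eq_zero_of_notMem_tsupport fun h => ht (hs h), zero_smul]

/-- A smooth function of zero mean with compact support in the open half line is the derivative
of another one. -/
theorem exists_deriv_eq_of_integral_eq_zero {η : ℝ → ℝ} (hη : ContDiff ℝ ∞ η)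
    (hc : HasCompactSupport η) (hs : tsupport η ⊆ Ioi (0 : ℝ)) (h0 : ∫ t, η t = 0) :
    ∃ φ : ℝ → ℂ, ContDiff ℝ ∞ φ ∧ HasCompactSupport φ ∧ tsupport φ ⊆ Ioi (0 : ℝ) ∧
      ∀ t, HasDerivAt φ (η t : ℂ) t := by
  have hηc : Continuous η := hη.continuous
  obtain ⟨a, ha0, b, hb0, ha, hb⟩ : ∃ a > (0 : ℝ), ∃ b > (0 : ℝ), (∀ t < a, η t = 0) ∧
      (∀ t > b, η t = 0) := by
    rcases (tsupport η).eq_empty_or_nonempty with he | hne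
    · have : ∀ t, η t = 0 := fun t => image_eq_zero_of_notMem_tsupport (by simp [he])
      exact ⟨1, one_pos, 1, one_pos, fun t _ => this t, fun t _ => this t⟩
    · obtain ⟨a, ha, ha'⟩ := hc.isCompact.exists_isLeast hne
      obtain ⟨b, hb, hb'⟩ := hc.isCompact.exists_isGreatest hne
      exact ⟨a, hs ha, b, hs hb,
        fun t ht => image_eq_zero_of_notMem_tsupport fun h => absurd (ha' h) (not_le.2 ht),
        fun t ht => image_eq_zero_of_notMem_tsupport fun h => absurd (hb' h) (not_le.2 ht)⟩
  set P : ℝ → ℝ := fun t => ∫ τ in (0 : ℝ)..t, η τ with hP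
  have hPd (t : ℝ) : HasDerivAt P (η t) t :=
    intervalIntegral.integral_hasDerivAt_right (hηc.intervalIntegrable _ _)
      (hηc.stronglyMeasurableAtFilter _ _) hηc.continuousAt
  have hPa (t : ℝ) (ht : t < a) : P t = 0 := by
    refine intervalIntegral.integral_zero_ae (Eventually.of_forall fun τ hτ => ha τ ?_)
    exact hτ.2.trans_lt (max_lt ha0 ht)
  have hPb (t : ℝ) (ht : b < t) : P t = 0 := by
    rw [hP]
    simp only
    rw [intervalIntegral.integral_of_le (hb0.trans ht).le]
    refine (setIntegral_eq_integral_of_forall_compl_eq_zero fun τ hτ => ?_).trans h0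
    rcases le_or_gt τ 0 with h | h
    · exact ha τ (h.trans_lt ha0)
    · exact hb τ (ht.trans (not_le.1 fun h' => hτ ⟨h, h'⟩))
  have hsupp : tsupport (fun t => (P t : ℂ)) ⊆ Icc a b := by
    refine closure_minimal (fun t ht => ?_) isClosed_Icc
    rw [Function.mem_support, Complex.ofReal_ne_zero] at ht
    exact ⟨not_lt.1 fun h => ht (hPa t h), not_lt.1 fun h => ht (hPb t h)⟩
  refine ⟨fun t => (P t : ℂ), ?_, ?_, ?_, fun t => (hPd t).ofReal_comp⟩
  · refine Complex.ofRealCLM.contDiff.comp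
      (contDiff_infty_iff_deriv.2 ⟨fun t => (hPd t).differentiableAt, ?_⟩)
    have : deriv P = η := funext fun t => (hPd t).deriv
    rwa [← this] at hη
  · exact isCompact_Icc.of_isClosed_subset (isClosed_tsupport _) hsupp
  · exact hsupp.trans fun t ht => ha0.trans_le ht.1

/-- The fundamental theorem of calculus for weak derivatives that are integrable near `0`. -/
theorem IsWeakDeriv.exists_eq_primitive [CompleteSpace X] {F f : ℝ → X} {γ C : ℝ}
    (hw : IsWeakDeriv F f) (hf : PrimitiveBound f γ C) :
    ∃ x, ∀ᵐ t ∂ν₊, F t = x + ∫ τ in Ioc 0 t, f τ := by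
  obtain ⟨hF, hfl, hw⟩ := hw
  set P : ℝ → X := fun t => ∫ τ in Ioc 0 t, f τ with hPdef
  have hP : MemL1Loc P :=
    (hf.continuousOn.mono Ioi_subset_Ici_self).locallyIntegrableOn measurableSet_Ioi
  set D : ℝ → X := fun t => F t - P t with hDdef
  have hD : MemL1Loc D := LocallyIntegrableOn.sub hF hP
  -- Against derivatives of test functions, `D` integrates to zero.
  have hzero (η : ℝ → ℝ) (hη : ContDiff ℝ ∞ η) (hc : HasCompactSupport η)
      (hs : tsupport η ⊆ Ioi (0 : ℝ)) (h0 : ∫ t, η t = 0) : ∫ t, η t • D t = 0 := by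
    obtain ⟨φ, hφ, hφc, hφs, hφd⟩ := exists_deriv_eq_of_integral_eq_zero hη hc hs h0
    have hηC : Continuous fun t => (η t : ℂ) := by fun_prop
    have h1 := hw φ hφ hφc hφs
    have hi : Integrable (fun t => (η t : ℂ)) :=
      hηC.integrable_of_hasCompactSupport (hc.comp_left (g := Complex.ofReal) rfl)
    have hγ : IntegrableOn (fun t : ℝ => t ^ γ * ‖(η t : ℂ)‖) (Ioi 0) := by
      have hl : LocallyIntegrableOn (fun t : ℝ => ((t ^ γ : ℝ) : ℂ)) (Ioi 0) :=
        ContinuousOn.locallyIntegrableOn (Complex.continuous_ofReal.comp_continuousOn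
          (continuousOn_id.rpow_const fun t ht => Or.inl (ne_of_gt ht))) measurableSet_Ioi
      refine ((MemL1Loc.integrable_smul hl hη.continuous hc hs).norm.integrableOn).congr ?_
      filter_upwards [ae_pos] with t ht
      simp [abs_of_nonneg (Real.rpow_nonneg ht.le γ), mul_comm]
    have hlim : Tendsto φ atTop (𝓝 0) := by
      rw [hasCompactSupport_iff_eventuallyEq, Filter.coclosedCompact_eq_cocompact] at hφc
      exact (hφc.filter_mono atTop_le_cocompact).tendsto
    have h2 := integral_deriv_smul_primitive (fun t _ => hφd t) hlim hi.integrableOn hγ hf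
    simp only [fun t => (hφd t).deriv] at h1
    rw [← h1, neg_neg, ← sub_eq_zero] at h2
    have e (g : ℝ → X) : ∫ t in Ioi (0 : ℝ), (η t : ℂ) • g t = ∫ t, η t • g t := by
      simp only [Complex.coe_smul]
      exact setIntegral_Ioi_eq_integral_of_tsupport hs g
    rw [e, e, ← integral_sub (MemL1Loc.integrable_smul hP hη.continuous hc hs)
      (MemL1Loc.integrable_smul hF hη.continuous hc hs)] at h2
    rw [← neg_eq_zero, ← integral_neg, ← h2]
    congr 1
    ext t
    simp only [hDdef, ← smul_sub, ← smul_neg, neg_sub]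
  -- The constant is the mean of `D` against a bump function `θ` of integral one: for a test
  -- function `g`, the difference `g - (∫ g) θ` is the derivative of a test function.
  let B : ContDiffBump (2 : ℝ) := ⟨1 / 2, 1, by norm_num, by norm_num⟩
  set θ : ℝ → ℝ := B.normed volume with hθdef
  have hθ : ContDiff ℝ ∞ θ := B.contDiff_normed
  have hθc : HasCompactSupport θ := B.hasCompactSupport_normed
  have hθs : tsupport θ ⊆ Ioi (0 : ℝ) := by
    rw [hθdef, B.tsupport_normed_eq, Real.closedBall_eq_Icc]
    intro t ht
    have h1 := ht.1
    change (0 : ℝ) < t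
    norm_num [B] at h1
    linarith
  have hθ1 : ∫ t, θ t = 1 := B.integral_normed
  refine ⟨∫ t, θ t • D t, ?_⟩
  set x : X := ∫ t, θ t • D t with hx
  have hDx : LocallyIntegrableOn (fun t => D t - x) (Ioi (0 : ℝ)) :=
    LocallyIntegrableOn.sub hD (locallyIntegrableOn_const x)
  have key := isOpen_Ioi.ae_eq_zero_of_integral_contDiff_smul_eq_zero hDx fun g hg hgc hgs => by
    have hgD := MemL1Loc.integrable_smul hD hg.continuous hgc hgs
    have hθD := MemL1Loc.integrable_smul hD hθ.continuous hθc hθs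
    have hgi : Integrable g := hg.continuous.integrable_of_hasCompactSupport hgc
    have hθi : Integrable θ := hθ.continuous.integrable_of_hasCompactSupport hθc
    set m : ℝ := ∫ t, g t with hm
    have hsub : tsupport (fun t => g t - m * θ t) ⊆ tsupport g ∪ tsupport θ := by
      refine closure_minimal (fun t ht => ?_) ((isClosed_tsupport _).union (isClosed_tsupport _))
      by_contra hcon
      rw [mem_union, not_or] at hcon
      refine ht ?_
      simp only
      rw [image_eq_zero_of_notMem_tsupport hcon.1, image_eq_zero_of_notMem_tsupport hcon.2]
      simp
    have h3 := hzero (fun t => g t - m * θ t) (hg.sub (contDiff_const.mul hθ))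
      ((hgc.isCompact.union hθc.isCompact).of_isClosed_subset (isClosed_tsupport _) hsub)
      (hsub.trans (union_subset hgs hθs))
      (by rw [integral_sub hgi (hθi.const_mul m), integral_const_mul, hθ1]; simp [hm])
    have h4 : ∫ t, (g t - m * θ t) • D t = (∫ t, g t • D t) - m • x := by
      have e : m • x = ∫ t, m • θ t • D t := by rw [integral_smul]
      have hi : Integrable fun t => m • θ t • D t := hθD.smul m
      rw [e, ← integral_sub hgD hi]
      simp only [sub_smul, mul_smul]
    have h5 : ∫ t, g t • (D t - x) = (∫ t, g t • D t) - m • x := by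
      rw [hm, ← integral_smul_const, ← integral_sub hgD (hgi.smul_const x)]
      congr 1
      ext t
      rw [smul_sub]
    rw [h5, ← h4, h3]
  filter_upwards [ae_restrict_of_ae key, ae_pos] with t ht ht0
  have := ht ht0
  rw [sub_eq_zero] at this
  rw [← this]
  exact (sub_add_cancel _ _).symm

/-- The trace of a function that is almost everywhere a constant plus a primitive is that constant.
The continuous representative is unique, since a null set has dense complement. -/
theorem hasTrace_iff {Y : Type*} [NormedAddCommGroup Y] [NormedSpace ℂ Y] {j : Y →L[ℂ] X}
    {u : ℝ → Y} {f : ℝ → X} {γ C : ℝ} {x y : X} (hf : PrimitiveBound f γ C)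
    (hu : ∀ᵐ t ∂ν₊, j (u t) = x + ∫ τ in Ioc 0 t, f τ) : HasTrace j u y ↔ y = x := by
  have hc : ContinuousOn (fun t => x + ∫ τ in Ioc 0 t, f τ) (Ioi (0 : ℝ)) :=
    continuousOn_const.add (hf.continuousOn.mono Ioi_subset_Ici_self)
  constructor
  · rintro ⟨v, hv, hvu, hvy⟩
    have he : EqOn v (fun t => x + ∫ τ in Ioc 0 t, f τ) (Ioi 0) :=
      Measure.eqOn_open_of_ae_eq (by filter_upwards [hu, hvu] with t h1 h2; rw [h2, h1])
        isOpen_Ioi hv hc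
    refine tendsto_nhds_unique hvy ((hf.tendsto x).congr' ?_)
    filter_upwards [self_mem_nhdsWithin] with t ht
    exact (he ht).symm
  · rintro rfl
    exact ⟨_, hc, hu.mono fun t ht => ht.symm, hf.tendsto y⟩

end WeakDerivative

/-! ### Coercive operators and the resolvent of a form -/

section LaxMilgram

variable {K : Type*} [NormedAddCommGroup K] [InnerProductSpace ℂ K]

/-- The complex Lax--Milgram theorem. -/
theorem bijective_of_coercive [CompleteSpace K] (T : K →L[ℂ] K) {c : ℝ} (hc : 0 < c)
    (hT : ∀ x, c * ‖x‖ ^ 2 ≤ (inner ℂ x (T x)).re) : Function.Bijective T := by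
  have hbound (x : K) : c * ‖x‖ ≤ ‖T x‖ := by
    rcases (norm_nonneg x).eq_or_lt with h | h
    · rw [← h]; simp
    · refine le_of_mul_le_mul_right ?_ h
      calc c * ‖x‖ * ‖x‖ = c * ‖x‖ ^ 2 := by ring
        _ ≤ (inner ℂ x (T x)).re := hT x
        _ ≤ ‖inner ℂ x (T x)‖ := Complex.re_le_norm _
        _ ≤ ‖x‖ * ‖T x‖ := norm_inner_le_norm _ _
        _ = _ := mul_comm _ _
  have hanti : AntilipschitzWith (c⁻¹).toNNReal T := by
    refine T.antilipschitz_of_bound fun x => ?_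
    rw [Real.coe_toNNReal _ (inv_nonneg.2 hc.le), inv_mul_eq_div, le_div_iff₀ hc, mul_comm]
    exact hbound x
  refine ⟨hanti.injective, ?_⟩
  have hcl : IsClosed (LinearMap.range (T : K →ₗ[ℂ] K) : Set K) := by
    rw [LinearMap.coe_range]
    exact hanti.isClosed_range T.uniformContinuous
  have := hcl.completeSpace_coe
  have hrange : LinearMap.range (T : K →ₗ[ℂ] K) = ⊤ := by
    rw [← Submodule.orthogonal_eq_bot_iff, Submodule.eq_bot_iff]
    intro x hx
    have h0 : inner ℂ (T x) x = 0 := hx _ ⟨x, rfl⟩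
    have h1 := hT x
    rw [← inner_conj_symm, h0] at h1
    simp only [map_zero, Complex.zero_re] at h1
    have : ‖x‖ ^ 2 ≤ 0 := by
      by_contra hcon
      exact absurd h1 (not_le.2 (mul_pos hc (not_le.1 hcon)))
    simpa using this
  exact LinearMap.range_eq_top.1 hrange

/-- The Lax--Milgram theorem on a closed subspace. -/
theorem exists_mem_forall_inner_eq (T : K →L[ℂ] K) {c : ℝ} (hc : 0 < c)
    (hT : ∀ x, c * ‖x‖ ^ 2 ≤ (inner ℂ x (T x)).re) (W : Submodule ℂ K) [CompleteSpace W] (y : K) :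
    ∃ x ∈ W, ∀ w ∈ W, inner ℂ w (T x) = inner ℂ w y := by
  let S : W →L[ℂ] W := W.orthogonalProjectionOnto ∘L T ∘L W.subtypeL
  have hS : ∀ x, c * ‖x‖ ^ 2 ≤ (inner ℂ x (S x)).re := fun x => by
    have : inner ℂ x (S x) = inner ℂ (x : K) (T x) :=
      Submodule.inner_orthogonalProjectionOnto_eq_of_mem_left x _
    rw [this]
    exact hT x
  obtain ⟨x, hx⟩ := (bijective_of_coercive S hc hS).2 (W.orthogonalProjectionOnto y)
  refine ⟨x, x.2, fun w hw => ?_⟩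
  have h1 : inner ℂ (⟨w, hw⟩ : W) (S x) = inner ℂ w (T x) :=
    Submodule.inner_orthogonalProjectionOnto_eq_of_mem_left _ _
  have h2 : inner ℂ (⟨w, hw⟩ : W) (W.orthogonalProjectionOnto y) = inner ℂ w y :=
    Submodule.inner_orthogonalProjectionOnto_eq_of_mem_left _ _
  rw [← h1, hx, h2]

end LaxMilgram

section Resolvent

variable {V H : Type*} [NormedAddCommGroup V] [InnerProductSpace ℂ V] [CompleteSpace V]
  [NormedAddCommGroup H] [InnerProductSpace ℂ H] [CompleteSpace H]

/-- The bounded operator on `V` representing the sesquilinear form `E` through the inner product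
of `V`. -/
def formMap (E : V →L[ℂ] V →L⋆[ℂ] ℂ) : V →L[ℂ] V :=
  (InnerProductSpace.continuousLinearMapOfBilin E.flip).adjoint

theorem inner_formMap (E : V →L[ℂ] V →L⋆[ℂ] ℂ) (u v : V) : inner ℂ v (formMap E u) = E u v := by
  rw [formMap, ContinuousLinearMap.adjoint_inner_right,
    InnerProductSpace.continuousLinearMapOfBilin_apply, ContinuousLinearMap.flip_apply]

/-- The resolvent `(l + A)⁻¹` of the operator associated with `E`, with values in `V`. The inverse
taken here is a true one for coercive `E` and `l ≥ 0`, by the Lax--Milgram theorem; otherwise it may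
be the default value `0`. -/
def formResolvent (i : V →L[ℂ] H) (E : V →L[ℂ] V →L⋆[ℂ] ℂ) (l : ℝ) : H →L[ℂ] V :=
  (formMap E + (l : ℂ) • (i.adjoint ∘L i)).inverse ∘L i.adjoint

variable {i : V →L[ℂ] H} {E : V →L[ℂ] V →L⋆[ℂ] ℂ} {μ : ℝ}

theorem inner_shift (l : ℝ) (u v : V) :
    inner ℂ v ((formMap E + (l : ℂ) • (i.adjoint ∘L i)) u) = E u v + l * inner ℂ (i v) (i u) := by
  simp [inner_formMap, ContinuousLinearMap.adjoint_inner_right]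

theorem shift_coercive (hE : ∀ u : V, μ * ‖u‖ ^ 2 ≤ (E u u).re) {l : ℝ} (hl : 0 ≤ l) (u : V) :
    μ * ‖u‖ ^ 2 ≤ (inner ℂ u ((formMap E + (l : ℂ) • (i.adjoint ∘L i)) u)).re := by
  rw [inner_shift, inner_self_eq_norm_sq_to_K]
  have : ((l : ℂ) * ((‖i u‖ : ℝ) : ℂ) ^ 2).re = l * ‖i u‖ ^ 2 := by
    rw [← Complex.ofReal_pow, ← Complex.ofReal_mul, Complex.ofReal_re]
  rw [Complex.add_re]
  change _ ≤ _ + ((l : ℂ) * ((‖i u‖ : ℝ) : ℂ) ^ 2).re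
  rw [this]
  nlinarith [hE u, mul_nonneg hl (sq_nonneg ‖i u‖)]

theorem formResolvent_eq_iff (hμ : 0 < μ) (hE : ∀ u : V, μ * ‖u‖ ^ 2 ≤ (E u u).re) {l : ℝ}
    (hl : 0 ≤ l) (y : H) (v : V) :
    formResolvent i E l y = v ↔ E v + (l : ℂ) • gelfand i (i v) = gelfand i y := by
  set T := formMap E + (l : ℂ) • (i.adjoint ∘L i) with hT
  have hbij := bijective_of_coercive T hμ (shift_coercive hE hl)
  have hinv : T.IsInvertible := by
    refine ⟨ContinuousLinearEquiv.ofBijective T (LinearMap.ker_eq_bot.2 hbij.1)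
      (LinearMap.range_eq_top.2 hbij.2), ?_⟩
    ext x
    simp
  have h1 : formResolvent i E l y = v ↔ T v = i.adjoint y := by
    have e : formResolvent i E l y = T.inverse (i.adjoint y) := rfl
    rw [e]
    exact hinv.inverse_apply_eq.trans eq_comm
  rw [h1]
  constructor
  · intro h
    ext w
    have := inner_shift (i := i) (E := E) l v w
    rw [← hT, h, ContinuousLinearMap.adjoint_inner_right] at this
    simp [gelfand_apply, this]
  · intro h
    refine ext_inner_left ℂ fun w => ?_
    rw [hT, inner_shift, ContinuousLinearMap.adjoint_inner_right]
    have := congrArg (fun f => f w) h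
    simpa [gelfand_apply] using this

theorem formResolvent_spec (hμ : 0 < μ) (hE : ∀ u : V, μ * ‖u‖ ^ 2 ≤ (E u u).re) {l : ℝ}
    (hl : 0 ≤ l) (y : H) :
    E (formResolvent i E l y) + (l : ℂ) • gelfand i (i (formResolvent i E l y))
      = gelfand i y := (formResolvent_eq_iff hμ hE hl y _).1 rfl

/-- Testing the resolvent equation with its solution. -/
theorem formResolvent_energy (hμ : 0 < μ) (hE : ∀ u : V, μ * ‖u‖ ^ 2 ≤ (E u u).re) {l : ℝ}
    (hl : 0 ≤ l) (y : H) :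
    μ * ‖formResolvent i E l y‖ ^ 2 + l * ‖i (formResolvent i E l y)‖ ^ 2
      ≤ ‖i (formResolvent i E l y)‖ * ‖y‖ := by
  set v := formResolvent i E l y with hv
  have h := congrArg (fun f => (f v).re) (formResolvent_spec (i := i) hμ hE hl y)
  simp only [add_apply, smul_apply, gelfand_apply,
    Complex.add_re, ← hv, inner_self_eq_norm_sq_to_K] at h
  have e : ((l : ℂ) • ((‖i v‖ : ℝ) : ℂ) ^ 2).re = l * ‖i v‖ ^ 2 := by
    rw [smul_eq_mul, ← Complex.ofReal_pow, ← Complex.ofReal_mul, Complex.ofReal_re]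
  change _ + ((l : ℂ) • ((‖i v‖ : ℝ) : ℂ) ^ 2).re = _ at h
  rw [e] at h
  calc _ ≤ (E v v).re + l * ‖i v‖ ^ 2 := by gcongr; exact hE v
    _ = (inner ℂ (i v) y).re := h
    _ ≤ ‖inner ℂ (i v) y‖ := Complex.re_le_norm _
    _ ≤ _ := norm_inner_le_norm _ _

theorem norm_formResolvent_le (hμ : 0 < μ) (hE : ∀ u : V, μ * ‖u‖ ^ 2 ≤ (E u u).re) {l : ℝ}
    (hl : 0 ≤ l) : ‖formResolvent i E l‖ ≤ ‖i‖ / μ := by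
  refine ContinuousLinearMap.opNorm_le_bound _ (by positivity) fun y => ?_
  have h := formResolvent_energy (i := i) hμ hE hl y
  set v := formResolvent i E l y
  rcases (norm_nonneg v).eq_or_lt with h0 | h0
  · rw [← h0]; positivity
  · rw [div_mul_eq_mul_div, le_div_iff₀ hμ]
    refine le_of_mul_le_mul_right ?_ h0
    calc ‖v‖ * μ * ‖v‖ = μ * ‖v‖ ^ 2 := by ring
      _ ≤ ‖i v‖ * ‖y‖ := by nlinarith [mul_nonneg hl (sq_nonneg ‖i v‖)]
      _ ≤ (‖i‖ * ‖v‖) * ‖y‖ := by gcongr; exact i.le_opNorm v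
      _ = _ := by ring

theorem norm_comp_formResolvent_le (hμ : 0 < μ) (hE : ∀ u : V, μ * ‖u‖ ^ 2 ≤ (E u u).re) {l : ℝ}
    (hl : 0 < l) : ‖i ∘L formResolvent i E l‖ ≤ l⁻¹ := by
  refine ContinuousLinearMap.opNorm_le_bound _ (by positivity) fun y => ?_
  have h := formResolvent_energy (i := i) hμ hE hl.le y
  rw [ContinuousLinearMap.comp_apply]
  set v := formResolvent i E l y
  rcases (norm_nonneg (i v)).eq_or_lt with h0 | h0
  · rw [← h0]; positivity
  · rw [inv_mul_eq_div, le_div_iff₀ hl]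
    refine le_of_mul_le_mul_right ?_ h0
    nlinarith [mul_nonneg hμ.le (sq_nonneg ‖v‖)]

/-- The decay `l ^ (-1 / 2)` of the resolvent as an operator from `H` to `V` combines the two
terms of the energy estimate. It makes `A ^ (-a)` map into `V` for `Re a > 1 / 2`. -/
theorem norm_formResolvent_le_rpow (hμ : 0 < μ) (hE : ∀ u : V, μ * ‖u‖ ^ 2 ≤ (E u u).re) {l : ℝ}
    (hl : 0 < l) : ‖formResolvent i E l‖ ≤ (√μ)⁻¹ * l ^ (-(1 / 2) : ℝ) := by
  refine ContinuousLinearMap.opNorm_le_bound _ (by positivity) fun y => ?_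
  have h := formResolvent_energy (i := i) hμ hE hl.le y
  have h2 := (i ∘L formResolvent i E l).le_of_opNorm_le (norm_comp_formResolvent_le hμ hE hl) y
  rw [ContinuousLinearMap.comp_apply] at h2
  set v := formResolvent i E l y
  rw [Real.rpow_neg hl.le, ← Real.sqrt_eq_rpow, ← mul_inv, ← Real.sqrt_mul hμ.le, inv_mul_eq_div,
    le_div_iff₀ (by positivity)]
  refine abs_le_of_sq_le_sq' ?_ (norm_nonneg y) |>.2
  rw [mul_pow, Real.sq_sqrt (by positivity)]
  calc ‖v‖ ^ 2 * (μ * l) = l * (μ * ‖v‖ ^ 2) := by ring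
    _ ≤ l * (‖i v‖ * ‖y‖) := by
      refine mul_le_mul_of_nonneg_left ?_ hl.le
      exact (le_add_of_nonneg_right (by positivity)).trans h
    _ ≤ l * ((l⁻¹ * ‖y‖) * ‖y‖) := by gcongr
    _ = ‖y‖ ^ 2 := by field_simp

/-- The resolvent identity. -/
theorem formResolvent_sub (hμ : 0 < μ) (hE : ∀ u : V, μ * ‖u‖ ^ 2 ≤ (E u u).re) {k l : ℝ}
    (hk : 0 ≤ k) (hl : 0 ≤ l) :
    formResolvent i E l - formResolvent i E k
      = ((k - l : ℝ) : ℂ) • (formResolvent i E k ∘L i ∘L formResolvent i E l) := by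
  ext y
  set v := formResolvent i E l y with hv
  have h : formResolvent i E k (y + ((k - l : ℝ) : ℂ) • i v) = v := by
    rw [formResolvent_eq_iff hμ hE hk, map_add, ← formResolvent_spec (i := i) hμ hE hl y, ← hv,
      map_smul]
    ext w
    simp only [add_apply, smul_apply, Complex.ofReal_sub, smul_eq_mul]
    ring
  simp only [sub_apply, smul_apply,
    ContinuousLinearMap.comp_apply, ← hv]
  nth_rewrite 1 [← h]
  rw [map_add, map_smul]
  simp

theorem continuousOn_formResolvent (hμ : 0 < μ) (hE : ∀ u : V, μ * ‖u‖ ^ 2 ≤ (E u u).re) :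
    ContinuousOn (formResolvent i E) (Ici 0) := by
  have : LipschitzOnWith (‖i‖ / μ * (‖i‖ * (‖i‖ / μ))).toNNReal (formResolvent i E) (Ici 0) := by
    refine LipschitzOnWith.of_dist_le_mul fun l hl k hk => ?_
    rw [dist_eq_norm, formResolvent_sub hμ hE hk hl, norm_smul, Complex.norm_real, dist_comm,
      Real.dist_eq, Real.norm_eq_abs, mul_comm, Real.coe_toNNReal _ (by positivity)]
    gcongr
    refine (ContinuousLinearMap.opNorm_comp_le _ _).trans ?_
    gcongr
    · exact norm_formResolvent_le hμ hE hk
    · refine (ContinuousLinearMap.opNorm_comp_le _ _).trans ?_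
      gcongr
      exact norm_formResolvent_le hμ hE hl
  exact this.continuousOn

/-- The inverse of `l + A` is the resolvent given by the Lax--Milgram theorem. -/
theorem shiftInverse_formOp (hi : Function.Injective i) (hd : DenseRange i)
    (hμ : 0 < μ) (hE : ∀ u : V, μ * ‖u‖ ^ 2 ≤ (E u u).re) {l : ℝ} (hl : 0 ≤ l) :
    shiftInverse (formOp i E) (l : ℂ) = i ∘L formResolvent i E l := by
  refine shiftInverse_eq fun x y => ?_
  rw [ContinuousLinearMap.comp_apply]
  have hgr (p : H × H) : p ∈ (formOp i E).graph ↔ ∃ v : V, i v = p.1 ∧ E v = gelfand i p.2 := by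
    rw [formOp_graph i E hi hd]; rfl
  constructor
  · intro h
    have hspec := formResolvent_spec (i := i) hμ hE hl y
    have hmem : (x, y - (l : ℂ) • x) ∈ (formOp i E).graph := by
      refine (hgr _).2 ⟨_, h, ?_⟩
      simp only
      rw [map_sub, map_smul, ← hspec, h]
      simp
    obtain ⟨z, hz, hz'⟩ := (LinearPMap.mem_graph_iff _).1 hmem
    simp only at hz hz'
    subst hz
    exact ⟨z.2, by rw [hz']; simp⟩
  · rintro ⟨hx, h⟩
    obtain ⟨v, hv, hv'⟩ := (hgr _).1 (LinearPMap.mem_graph (formOp i E) ⟨x, hx⟩)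
    simp only at hv hv'
    have : formResolvent i E l y = v := by
      rw [formResolvent_eq_iff hμ hE hl, hv', ← h, hv, map_add, map_smul, add_comm]
    rw [this, hv]

end Resolvent

/-! ### Negative fractional powers and complex interpolation -/

section Mellin

variable {X : Type*} [NormedAddCommGroup X] [NormedSpace ℂ X]

theorem ofReal_rpow_smul_eq {l : ℝ} (hl : 0 < l) (s : ℝ) (x : X) :
    ((l : ℂ) ^ ((1 - s : ℂ) - 1)) • x = (l ^ (-s) : ℝ) • x := by
  rw [show (1 - s : ℂ) - 1 = ((-s : ℝ) : ℂ) by push_cast; ring, ← Complex.ofReal_cpow hl.le,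
    Complex.coe_smul]

/-- The Mellin transform is bounded on closed vertical strips inside its domain of convergence. -/
theorem norm_mellin_le {f : ℝ → X} {w : ℂ} {a b : ℝ} (ha : MellinConvergent f a)
    (hb : MellinConvergent f b) (haw : a ≤ w.re) (hwb : w.re ≤ b) :
    ‖mellin f w‖ ≤ ∫ l in Ioi (0 : ℝ),
      (‖(l : ℂ) ^ ((a : ℂ) - 1) • f l‖ + ‖(l : ℂ) ^ ((b : ℂ) - 1) • f l‖) := by
  refine norm_integral_le_of_norm_le (Integrable.add ha.norm hb.norm) ?_
  filter_upwards [ae_pos] with l hl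
  simp only [norm_smul, Complex.norm_cpow_eq_rpow_re_of_pos hl, Complex.sub_re, Complex.one_re,
    Complex.ofReal_re]
  rw [← add_mul]
  refine mul_le_mul_of_nonneg_right ?_ (norm_nonneg _)
  rcases le_total l 1 with h1 | h1
  · exact (Real.rpow_le_rpow_of_exponent_ge hl h1 (by linarith)).trans
      (le_add_of_nonneg_right (by positivity))
  · exact (Real.rpow_le_rpow_of_exponent_le h1 (by linarith)).trans
      (le_add_of_nonneg_left (by positivity))

end Mellin

section Interpolation

variable {V H : Type*} [NormedAddCommGroup V] [InnerProductSpace ℂ V] [CompleteSpace V]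
  [NormedAddCommGroup H] [InnerProductSpace ℂ H] [CompleteSpace H]
  {i : V →L[ℂ] H} {E : V →L[ℂ] V →L⋆[ℂ] ℂ} {μ : ℝ}

theorem mellinConvergent_and_differentiableAt {X : Type*} [NormedAddCommGroup X] [NormedSpace ℂ X]
    {f : ℝ → X} (hf : ContinuousOn f (Ici 0)) {C D a : ℝ} (hC : ∀ l, 0 < l → ‖f l‖ ≤ C)
    (hD : ∀ l, 0 < l → ‖f l‖ ≤ D * l ^ (-a)) {w : ℂ} (h0 : 0 < w.re) (ha : w.re < a) :
    MellinConvergent f w ∧ DifferentiableAt ℂ (mellin f) w := by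
  have h1 : LocallyIntegrableOn f (Ioi 0) :=
    (hf.mono Ioi_subset_Ici_self).locallyIntegrableOn measurableSet_Ioi
  have h2 : f =O[atTop] fun l : ℝ => l ^ (-a) := by
    refine Asymptotics.IsBigO.of_bound D ?_
    filter_upwards [eventually_gt_atTop 0] with l hl
    rw [Real.norm_of_nonneg (Real.rpow_nonneg hl.le _)]
    exact hD l hl
  have h3 : f =O[𝓝[>] 0] fun l : ℝ => l ^ (-(0 : ℝ)) := by
    refine Asymptotics.IsBigO.of_bound C ?_
    filter_upwards [self_mem_nhdsWithin] with l hl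
    simpa using hC l hl
  exact ⟨mellinConvergent_of_isBigO_rpow h1 h2 ha h3 h0,
    mellin_differentiableAt_of_isBigO_rpow h1 h2 ha h3 h0⟩

theorem mellin_comp_formResolvent (hμ : 0 < μ) (hE : ∀ u : V, μ * ‖u‖ ^ 2 ≤ (E u u).re) {w : ℂ}
    (h0 : 0 < w.re) (h1 : w.re < 1) :
    MellinConvergent (fun l => i ∘L formResolvent i E l) w ∧
      DifferentiableAt ℂ (mellin fun l => i ∘L formResolvent i E l) w := by
  refine mellinConvergent_and_differentiableAt (C := ‖i‖ * (‖i‖ / μ)) (D := 1) (a := 1) ?_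
    (fun l hl => ?_) (fun l hl => ?_) h0 h1
  · exact continuousOn_const.clm_comp (continuousOn_formResolvent hμ hE)
  · refine (ContinuousLinearMap.opNorm_comp_le _ _).trans ?_
    gcongr
    exact norm_formResolvent_le hμ hE hl.le
  · rw [one_mul, Real.rpow_neg_one]
    exact norm_comp_formResolvent_le hμ hE hl

theorem mellin_formResolvent (hμ : 0 < μ) (hE : ∀ u : V, μ * ‖u‖ ^ 2 ≤ (E u u).re) {w : ℂ}
    (h0 : 0 < w.re) (h1 : w.re < 1 / 2) :
    MellinConvergent (formResolvent i E) w ∧ DifferentiableAt ℂ (mellin (formResolvent i E)) w :=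
  mellinConvergent_and_differentiableAt (continuousOn_formResolvent hμ hE)
    (fun _ hl => norm_formResolvent_le hμ hE hl.le)
    (fun _ hl => norm_formResolvent_le_rpow hμ hE hl) h0 h1

variable {s : ℝ}

theorem integrableOn_rpow_smul_comp_formResolvent (hμ : 0 < μ)
    (hE : ∀ u : V, μ * ‖u‖ ^ 2 ≤ (E u u).re) (hs0 : 0 < s) (hs1 : s < 1) :
    IntegrableOn (fun l : ℝ => (l ^ (-s) : ℝ) • (i ∘L formResolvent i E l)) (Ioi 0) := by
  have h := (mellin_comp_formResolvent (i := i) (w := (1 - s : ℂ)) hμ hE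
    (by simpa using hs1) (by simpa using hs0)).1
  exact IntegrableOn.congr_fun h (fun l hl => ofReal_rpow_smul_eq hl s _) measurableSet_Ioi

theorem negFracPow_formOp (hi : Function.Injective i) (hd : DenseRange i)
    (hμ : 0 < μ) (hE : ∀ u : V, μ * ‖u‖ ^ 2 ≤ (E u u).re) :
    negFracPow (formOp i E) s = (Real.sin (Real.pi * s) / Real.pi : ℝ) •
      ∫ l in Ioi (0 : ℝ), (l ^ (-s) : ℝ) • (i ∘L formResolvent i E l) := by
  rw [negFracPow]
  congr 1
  refine setIntegral_congr_fun measurableSet_Ioi fun l hl => ?_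
  rw [shiftInverse_formOp hi hd hμ hE (le_of_lt hl)]

theorem negFracPow_formOp_apply (hi : Function.Injective i) (hd : DenseRange i)
    (hμ : 0 < μ) (hE : ∀ u : V, μ * ‖u‖ ^ 2 ≤ (E u u).re) (hs0 : 0 < s) (hs1 : s < 1) (y : H) :
    negFracPow (formOp i E) s y = (Real.sin (Real.pi * s) / Real.pi : ℝ) •
      ∫ l in Ioi (0 : ℝ), (l ^ (-s) : ℝ) • i (formResolvent i E l y) := by
  rw [negFracPow_formOp hi hd hμ hE, smul_apply,
    ContinuousLinearMap.integral_apply (integrableOn_rpow_smul_comp_formResolvent hμ hE hs0 hs1)]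
  rfl

/-- The range of `A ^ (-s)` lies in `[H, V]_s`. The function on the strip is, up to a constant,
`z ↦ ∫ l ^ (-(z + s) / 2) (l + A)⁻¹ y dl`, a multiple of `A ^ (-(z + s) / 2) y`. On `Re z = 1` its
exponent has real part larger than `1 / 2`, so that the integral converges in `V`. -/
theorem negFracPow_mem_complexInterp (hi : Function.Injective i) (hd : DenseRange i)
    (hμ : 0 < μ) (hE : ∀ u : V, μ * ‖u‖ ^ 2 ≤ (E u u).re) (hs0 : 0 < s) (hs1 : s < 1) (y : H) :
    negFracPow (formOp i E) s y ∈ complexInterp i s := by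
  set c : ℝ := Real.sin (Real.pi * s) / Real.pi with hc
  set F : ℝ → H →L[ℂ] H := fun l => i ∘L formResolvent i E l with hF
  -- The Mellin transform at `η z` integrates against `l ^ (η z - 1) = l ^ (-(z + s) / 2)`.
  set η : ℂ → ℂ := fun z => 1 - (z + s) / 2 with hη
  have hηre (z : ℂ) : (η z).re = 1 - (z.re + s) / 2 := by
    have : (η z) = 1 - (z + s) * ((1 / 2 : ℝ) : ℂ) := by simp [hη]; ring
    rw [this]
    simp only [Complex.sub_re, Complex.one_re, Complex.re_mul_ofReal, Complex.add_re,
      Complex.ofReal_re]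
    ring
  have hηd : Differentiable ℂ η := by fun_prop
  have hFd (z : ℂ) (h0 : 0 ≤ z.re) (h1 : z.re ≤ 1) : DifferentiableAt ℂ (mellin F) (η z) :=
    (mellin_comp_formResolvent hμ hE (by rw [hηre]; linarith) (by rw [hηre]; linarith)).2
  have hfd (z : ℂ) (h0 : 0 ≤ z.re) (h1 : z.re ≤ 1) :
      DifferentiableAt ℂ (fun z => c • mellin F (η z) y) z :=
    (((hFd z h0 h1).comp z hηd.differentiableAt).clm_apply
      (differentiableAt_const y)).const_smul c
  have hFc (a : ℝ) (h0 : 0 < a) (h1 : a < 1) : MellinConvergent F a :=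
    (mellin_comp_formResolvent hμ hE (by simpa using h0) (by simpa using h1)).1
  have hline (t : ℝ) : (η (1 + t * Complex.I)).re = (1 - s) / 2 := by
    rw [hηre]
    simp
    ring
  have hR (t : ℝ) := mellin_formResolvent (i := i) (w := η (1 + t * Complex.I)) hμ hE
    (by rw [hline]; linarith) (by rw [hline]; linarith)
  refine ⟨fun z => c • mellin F (η z) y, ?_, ?_, ?_, ?_, ?_⟩
  · exact fun z hz => (hfd z hz.1 hz.2).continuousAt.continuousWithinAt
  · refine ⟨‖c‖ * ((∫ l in Ioi (0 : ℝ), (‖(l : ℂ) ^ ((((1 - s) / 2 : ℝ) : ℂ) - 1) • F l‖ +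
      ‖(l : ℂ) ^ (((1 - s / 2 : ℝ) : ℂ) - 1) • F l‖)) * ‖y‖), fun z h0 h1 => ?_⟩
    rw [norm_smul]
    gcongr
    refine ContinuousLinearMap.le_of_opNorm_le _ ?_ y
    exact norm_mellin_le (hFc _ (by linarith) (by linarith)) (hFc _ (by linarith) (by linarith))
      (by rw [hηre]; linarith) (by rw [hηre]; linarith)
  · exact fun z hz => (hfd z hz.1.le hz.2.le).differentiableWithinAt
  · refine ⟨fun t => c • mellin (formResolvent i E) (η (1 + t * Complex.I)) y, ?_, ?_, fun t => ?_⟩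
    · refine Continuous.const_smul ?_ c
      refine Continuous.clm_apply (continuous_iff_continuousAt.2 fun t => ?_) continuous_const
      have h1 : Continuous fun t : ℝ => η (1 + t * Complex.I) := by fun_prop
      exact ContinuousAt.comp (g := mellin (formResolvent i E)) (hR t).2.continuousAt
        h1.continuousAt
    · refine ⟨‖c‖ * ((∫ l in Ioi (0 : ℝ),
        (‖(l : ℂ) ^ ((((1 - s) / 2 : ℝ) : ℂ) - 1) • formResolvent i E l‖ +
          ‖(l : ℂ) ^ ((((1 - s) / 2 : ℝ) : ℂ) - 1) • formResolvent i E l‖)) * ‖y‖), fun t => ?_⟩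
      rw [norm_smul]
      gcongr
      refine ContinuousLinearMap.le_of_opNorm_le _ ?_ y
      have h2 : MellinConvergent (formResolvent i E) (((1 - s) / 2 : ℝ) : ℂ) :=
        (mellin_formResolvent hμ hE (by rw [Complex.ofReal_re]; linarith)
          (by rw [Complex.ofReal_re]; linarith)).1
      exact norm_mellin_le h2 h2 (hline t).ge (hline t).le
    · simp only
      have h2 : mellin F (η (1 + t * Complex.I))
          = i ∘L mellin (formResolvent i E) (η (1 + t * Complex.I)) := by
        have := (ContinuousLinearMap.compL ℂ H V H i).integral_comp_comm (hR t).1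
        simp only [ContinuousLinearMap.compL_apply] at this
        rw [mellin, mellin, ← this]
        congr 1
        ext l
        simp [hF]
      rw [h2, ContinuousLinearMap.comp_apply, ← Complex.coe_smul, ← Complex.coe_smul, map_smul]
  · simp only
    have h2 : η (s : ℂ) = 1 - s := by simp [hη]
    rw [negFracPow_formOp hi hd hμ hE, smul_apply, h2, ← hc, mellin]
    congr 2
    exact setIntegral_congr_fun measurableSet_Ioi fun l hl => ofReal_rpow_smul_eq hl s _

end Interpolation

/-! ### Gaussian averages on the half line -/

section Gauss

variable {X : Type*} [NormedAddCommGroup X] [NormedSpace ℂ X]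

/-- Differentiation under the integral sign with the exponential weights `e ^ (-r m(t))`. -/
theorem hasDerivAt_integral_exp_smul {κ m : ℝ → ℝ} {f : ℝ → X} (hm : ∀ t : ℝ, 0 < t → 0 ≤ m t)
    (h0 : ∀ r : ℝ, 0 < r → Integrable (fun t => (κ t * Real.exp (-(r * m t))) • f t) ν₊)
    (h1 : ∀ r : ℝ, 0 < r → Integrable (fun t => (κ t * m t * Real.exp (-(r * m t))) • f t) ν₊)
    {r : ℝ} (hr : 0 < r) :
    HasDerivAt (fun r => ∫ t in Ioi (0 : ℝ), (κ t * Real.exp (-(r * m t))) • f t)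
      (-∫ t in Ioi (0 : ℝ), (κ t * m t * Real.exp (-(r * m t))) • f t) r := by
  rw [← integral_neg]
  refine (hasDerivAt_integral_of_dominated_loc_of_deriv_le (s := Ioi (r / 2))
    (F' := fun r t => -((κ t * m t * Real.exp (-(r * m t))) • f t))
    (bound := fun t => ‖(κ t * m t * Real.exp (-(r / 2 * m t))) • f t‖)
    (Ioi_mem_nhds (by linarith)) ?_ (h0 r hr) (h1 r hr).1.neg ?_ (h1 _ (by linarith)).norm ?_).2
  · filter_upwards [Ioi_mem_nhds hr] with r' hr'
    exact (h0 r' hr').1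
  · filter_upwards [ae_pos] with t ht r' hr'
    rw [norm_neg, norm_smul, norm_smul, norm_mul, norm_mul (κ t * m t),
      Real.norm_eq_abs (Real.exp _), Real.norm_eq_abs (Real.exp _), Real.abs_exp, Real.abs_exp]
    gcongr
    · exact hm t ht
    · exact le_of_lt hr'
  · refine Eventually.of_forall fun t r' _ => ?_
    have h : HasDerivAt (fun r => κ t * Real.exp (-(r * m t)))
        (κ t * (Real.exp (-(r' * m t)) * -(1 * m t))) r' :=
      (((hasDerivAt_id r').mul_const (m t)).neg.exp).const_mul (κ t)
    convert h.smul_const (f t) using 1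
    rw [← neg_smul]
    congr 1
    ring

theorem integrable_rpow_mul_gauss {b q : ℝ} (hb : -1 < b) (hq : 0 < q) :
    Integrable (fun t : ℝ => t ^ b * Real.exp (-(q * t ^ 2))) ν₊ := by
  simpa [neg_mul, IntegrableOn] using integrableOn_rpow_mul_exp_neg_mul_sq hq hb

theorem integrable_gauss_smul {a b q : ℝ} {f : ℝ → X}
    (hf : MemLp (fun t : ℝ => (t ^ a : ℝ) • f t) 2 ν₊) (hq : 0 < q) (hb : a - 1 / 2 < b) :
    Integrable (fun t : ℝ => (t ^ b * Real.exp (-(q * t ^ 2))) • f t) ν₊ := by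
  refine integrable_smul_of_memLp hf ?_
  simp only [RCLike.ofReal_real_eq_id, id]
  rw [memLp_two_iff_integrable_sq (by fun_prop)]
  refine (integrable_rpow_mul_gauss (b := 2 * (b - a)) (q := 2 * q) (by linarith)
    (by linarith)).congr ?_
  filter_upwards [ae_pos] with t ht
  rw [← mul_assoc, ← Real.rpow_add ht, mul_pow, ← Real.rpow_mul_natCast ht.le, ← Real.exp_nat_mul]
  congr 2
  · push_cast; ring
  · push_cast; ring

theorem integral_rpow_mul_gauss {b q : ℝ} (hb : -1 < b) (hq : 0 < q) :
    ∫ t in Ioi (0 : ℝ), t ^ b * Real.exp (-(q * t ^ 2))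
      = Real.Gamma ((b + 1) / 2) / 2 * q ^ (-(b + 1) / 2) := by
  have h := integral_rpow_mul_exp_neg_mul_rpow (p := 2) two_pos hb hq
  simp only [Real.rpow_two, neg_mul] at h
  rw [h]
  ring

theorem tendsto_rpow_mul_gauss (b : ℝ) {q : ℝ} (hq : 0 < q) :
    Tendsto (fun t : ℝ => t ^ b * Real.exp (-(q * t ^ 2))) atTop (𝓝 0) := by
  have h := (rpow_mul_exp_neg_mul_sq_isLittleO_exp_neg hq b).trans_tendsto
    (Real.tendsto_exp_neg_atTop_nhds_zero.comp (tendsto_id.const_mul_atTop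
      (half_pos one_pos)) |>.congr fun t => by simp)
  simpa [neg_mul] using h

/-- Integration by parts on the half line against a function with an integrable derivative. -/
theorem integral_deriv_smul_eq {𝕜 : Type*} [RCLike 𝕜] [NormedSpace 𝕜 X] [CompleteSpace X]
    {ψ ψ' : ℝ → 𝕜} {F f : ℝ → X} {x : X} {γ C : ℝ} (hψ0 : ContinuousWithinAt ψ (Ici 0) 0)
    (hψ : ∀ t : ℝ, 0 < t → HasDerivAt ψ (ψ' t) t) (hψt : Tendsto ψ atTop (𝓝 0))
    (hψi : IntegrableOn ψ' (Ioi 0)) (hψγ : IntegrableOn (fun t : ℝ => t ^ γ * ‖ψ' t‖) (Ioi 0))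
    (hf : PrimitiveBound f γ C) (hF : ∀ᵐ t ∂ν₊, F t = x + ∫ τ in Ioc 0 t, f τ) :
    ∫ t in Ioi (0 : ℝ), ψ' t • F t = -(ψ 0 • x) - ∫ t in Ioi (0 : ℝ), ψ t • f t := by
  have h1 := integral_deriv_smul_primitive hψ hψt hψi hψγ hf
  have h2 : ∫ t in Ioi (0 : ℝ), ψ' t = 0 - ψ 0 :=
    integral_Ioi_of_hasDerivAt_of_tendsto hψ0 hψ hψi hψt
  have hP : Integrable (fun t => ψ' t • ∫ τ in Ioc 0 t, f τ) ν₊ := by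
    refine (hψγ.const_mul C).mono' (hψi.1.smul ?_) ?_
    · exact (hf.continuousOn.mono Ioi_subset_Ici_self).aestronglyMeasurable measurableSet_Ioi
    · filter_upwards [ae_pos] with t ht
      rw [norm_smul]
      calc _ ≤ ‖ψ' t‖ * (C * t ^ γ) := by gcongr; exact hf.norm_le ht
        _ = _ := by ring
  have h3 : ∫ t in Ioi (0 : ℝ), ψ' t • F t
      = (∫ t in Ioi (0 : ℝ), ψ' t • x) + ∫ t in Ioi (0 : ℝ), ψ' t • ∫ τ in Ioc 0 t, f τ := by
    rw [← integral_add (hψi.smul_const x) hP]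
    refine integral_congr_ae ?_
    filter_upwards [hF] with t ht
    rw [ht, smul_add]
  rw [h3, h1, integral_smul_const, h2, zero_sub, neg_smul, sub_eq_add_neg]

end Gauss

/-! ### Uniqueness for the backward evolution equation -/

section Backward

variable {V H : Type*} [NormedAddCommGroup V] [InnerProductSpace ℂ V]
  [NormedAddCommGroup H] [InnerProductSpace ℂ H]
  {i : V →L[ℂ] H} {E : V →L[ℂ] V →L⋆[ℂ] ℂ} {μ : ℝ}

/-- A solution of `w' = 𝒜 w` on `(0, ∞)` of at most linear growth vanishes: by coercivity,
`e ^ (-κ r) ‖w(r)‖²` is nondecreasing for some `κ > 0`, while it tends to `0` at infinity. -/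
theorem eq_zero_of_backward (hμ : 0 < μ) (hE : ∀ u : V, μ * ‖u‖ ^ 2 ≤ (E u u).re) {w w' : ℝ → V}
    (hw : ∀ r : ℝ, 0 < r → HasDerivAt w (w' r) r)
    (hode : ∀ r : ℝ, 0 < r → gelfand i (i (w' r)) = E (w r)) {C : ℝ}
    (hC : ∀ r : ℝ, 0 < r → ‖i (w r)‖ ≤ C * (1 + r)) {r : ℝ} (hr : 0 < r) : i (w r) = 0 := by
  -- The growth rate of `‖w‖²`; the summand `1` only avoids a division by zero when `i = 0`.
  set κ : ℝ := 2 * μ / (‖i‖ ^ 2 + 1) with hκ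
  have hκ0 : 0 < κ := by positivity
  set M : ℝ → ℝ := fun r => ‖i (w r)‖ ^ 2 * Real.exp (-(κ * r)) with hM
  have hMd (r : ℝ) (hr : 0 < r) : HasDerivAt M (2 * (E (w r) (w r)).re * Real.exp (-(κ * r))
      + ‖i (w r)‖ ^ 2 * (Real.exp (-(κ * r)) * -(κ * 1))) r := by
    have h1 : HasDerivAt (fun r => i (w r)) (i (w' r)) r :=
      (i.restrictScalars ℝ).hasFDerivAt.comp_hasDerivAt r (hw r hr)
    let _ := InnerProductSpace.complexToReal (G := H)
    have h2 := h1.norm_sq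
    have h3 : inner ℝ (i (w r)) (i (w' r)) = (E (w r) (w r)).re := by
      rw [← hode r hr, gelfand_apply]
      rfl
    rw [h3] at h2
    exact h2.mul (((hasDerivAt_id r).const_mul κ).neg.exp)
  have hmono : MonotoneOn M (Ioi 0) := by
    refine monotoneOn_of_deriv_nonneg (convex_Ioi 0)
      (fun r hr => (hMd r hr).continuousAt.continuousWithinAt) ?_ ?_
    · rw [interior_Ioi]
      exact fun r hr => (hMd r hr).differentiableAt.differentiableWithinAt
    · rw [interior_Ioi]
      intro r hr
      rw [(hMd r hr).deriv]
      have h1 : κ * ‖i (w r)‖ ^ 2 ≤ 2 * (E (w r) (w r)).re := by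
        have h2 : ‖i (w r)‖ ^ 2 ≤ (‖i‖ ^ 2 + 1) * ‖w r‖ ^ 2 := by
          have : ‖i (w r)‖ ^ 2 ≤ (‖i‖ * ‖w r‖) ^ 2 := by gcongr; exact i.le_opNorm _
          nlinarith [sq_nonneg ‖w r‖]
        calc κ * ‖i (w r)‖ ^ 2 ≤ κ * ((‖i‖ ^ 2 + 1) * ‖w r‖ ^ 2) := by gcongr
          _ = 2 * (μ * ‖w r‖ ^ 2) := by rw [hκ]; field_simp
          _ ≤ _ := by gcongr; exact hE _
      have h2 := mul_le_mul_of_nonneg_right h1 (Real.exp_pos (-(κ * r))).le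
      linarith
  have hlim : Tendsto (fun R : ℝ => C ^ 2 * ((1 + R) ^ 2 * Real.exp (-(κ * R)))) atTop (𝓝 0) := by
    have e (n : ℕ) : Tendsto (fun R : ℝ => R ^ n * Real.exp (-(κ * R))) atTop (𝓝 0) := by
      simpa [neg_mul] using tendsto_rpow_mul_exp_neg_mul_atTop_nhds_zero n κ hκ0
    have h := ((((e 0).add ((e 1).const_mul 2)).add (e 2)).const_mul (C ^ 2))
    simp only [mul_zero, add_zero] at h
    refine h.congr fun R => ?_
    ring
  have hle : M r ≤ 0 := by
    refine ge_of_tendsto hlim ?_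
    filter_upwards [eventually_gt_atTop r] with R hR
    refine (hmono hr (hr.trans hR) hR.le).trans ?_
    have := hC R (hr.trans hR)
    calc M R ≤ (C * (1 + R)) ^ 2 * Real.exp (-(κ * R)) := by
          simp only [hM]
          gcongr
      _ = _ := by ring
  have h0 : ‖i (w r)‖ ^ 2 ≤ 0 := by
    by_contra hcon
    exact absurd hle (not_le.2 (mul_pos (not_le.1 hcon) (Real.exp_pos _)))
  simpa using h0

end Backward

/-! ### The trace of a harmonic function in terms of its conormal derivative -/

section Identification

variable {V H : Type*} [NormedAddCommGroup V] [NormedSpace ℂ V]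
  [NormedAddCommGroup H] [NormedSpace ℂ H]
  {X : Type*} [NormedAddCommGroup X] [NormedSpace ℂ X]
  {i : V →L[ℂ] H} {j : H →L[ℂ] X} {E : V →L[ℂ] X} {s : ℝ}

/-- `u` solves `-(t^{1-2s} u')' + t^{1-2s} 𝒜 u = 0` with derivative `p`, initial value `x` and
conormal derivative `-lim_{t ↓ 0} t^{1-2s} u'(t) = z ∈ H`, in the integrated form. The antidual of
`V` is replaced by any space `X` into which `H` is mapped by `j`, as the computations with Gaussian
averages only use the linearity of `E` in its first argument. -/
structure IsSolution (i : V →L[ℂ] H) (j : H →L[ℂ] X) (E : V →L[ℂ] X) (s : ℝ) (u : ℝ → V) (p : ℝ → H)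
    (x z : H) : Prop where
  memLp : MemLp (fun t : ℝ => (t ^ (1 / 2 - s) : ℝ) • u t) 2 ν₊
  memLp_deriv : MemLp (fun t : ℝ => (t ^ (1 / 2 - s) : ℝ) • p t) 2 ν₊
  eq_primitive : ∀ᵐ t ∂ν₊, i (u t) = x + ∫ τ in Ioc 0 t, p τ
  conormal_eq : ∀ᵐ t ∂ν₊, j ((t ^ (1 - 2 * s) : ℝ) • p t)
    = -j z + ∫ τ in Ioc 0 t, (τ ^ (1 - 2 * s) : ℝ) • E (u τ)

theorem memLp_rpow_smul_form {u : ℝ → V}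
    (hu : MemLp (fun t : ℝ => (t ^ (1 / 2 - s) : ℝ) • u t) 2 ν₊) :
    MemLp (fun t : ℝ => (t ^ (s - 1 / 2) : ℝ) • (t ^ (1 - 2 * s) : ℝ) • E (u t)) 2 ν₊ := by
  refine ((E.restrictScalars ℝ).comp_memLp' hu).ae_eq ?_
  filter_upwards [ae_pos] with t ht
  simp only [Function.comp, ContinuousLinearMap.coe_restrictScalars', smul_smul, ← Real.rpow_add ht]
  rw [show s - 1 / 2 + (1 - 2 * s) = 1 / 2 - s by ring]
  exact (E.restrictScalars ℝ).map_smul _ _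

/-- The Gaussian average `∫ t ^ (1 - 2 s) e ^ (-q t²) u(t) dt`. -/
def gaussAvg (s : ℝ) (u : ℝ → V) (q : ℝ) : V :=
  ∫ t in Ioi (0 : ℝ), (t ^ (1 - 2 * s) * Real.exp (-(q * t ^ 2))) • u t

/-- The second moment `∫ t ^ (1 - 2 s) t² e ^ (-q t²) u(t) dt`, which is minus the
derivative of the Gaussian average. -/
def gaussMoment (s : ℝ) (u : ℝ → V) (q : ℝ) : V :=
  ∫ t in Ioi (0 : ℝ), (t ^ (1 - 2 * s) * t ^ 2 * Real.exp (-(q * t ^ 2))) • u t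

theorem hasDerivAt_gauss (q t : ℝ) :
    HasDerivAt (fun t : ℝ => Real.exp (-(q * t ^ 2)))
      (-(2 * q) * (t * Real.exp (-(q * t ^ 2)))) t := by
  have h : HasDerivAt (fun t : ℝ => Real.exp (-(q * t ^ 2)))
      (Real.exp (-(q * t ^ 2)) * -(q * (2 * t ^ (2 - 1) * 1))) t := by
    exact_mod_cast (((hasDerivAt_id t).pow 2).const_mul q).neg.exp
  convert h using 1
  ring

variable {u : ℝ → V} {p : ℝ → H} {x z : H}

theorem integrable_gaussAvg (hs1 : s < 1)
    (hu : MemLp (fun t : ℝ => (t ^ (1 / 2 - s) : ℝ) • u t) 2 ν₊) {q : ℝ} (hq : 0 < q) :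
    Integrable (fun t : ℝ => (t ^ (1 - 2 * s) * Real.exp (-(q * t ^ 2))) • u t) ν₊ :=
  integrable_gauss_smul hu hq (by linarith)

theorem integrable_gaussMoment (hs1 : s < 1)
    (hu : MemLp (fun t : ℝ => (t ^ (1 / 2 - s) : ℝ) • u t) 2 ν₊) {q : ℝ} (hq : 0 < q) :
    Integrable (fun t : ℝ => (t ^ (1 - 2 * s) * t ^ 2 * Real.exp (-(q * t ^ 2))) • u t) ν₊ := by
  refine (integrable_gauss_smul (b := 1 - 2 * s + 2) hu hq (by linarith)).congr ?_
  filter_upwards [ae_pos] with t ht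
  rw [Real.rpow_add ht, Real.rpow_two]

theorem hasDerivAt_gaussAvg (hs1 : s < 1)
    (hu : MemLp (fun t : ℝ => (t ^ (1 / 2 - s) : ℝ) • u t) 2 ν₊) {q : ℝ} (hq : 0 < q) :
    HasDerivAt (gaussAvg s u) (-gaussMoment s u q) q :=
  hasDerivAt_integral_exp_smul (κ := fun t => t ^ (1 - 2 * s)) (m := fun t => t ^ 2)
    (fun t _ => sq_nonneg t) (fun _ hr => integrable_gaussAvg hs1 hu hr)
    (fun _ hr => integrable_gaussMoment hs1 hu hr) hq

/-- The rescaled Gaussian average `r ^ (s - 1) ∫ t ^ (1 - 2 s) e ^ (-t² / (4 r)) u(t) dt`. The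
scaling turns the Bessel equation for `u` into a first order equation in `r`. -/
def heatAvg (s : ℝ) (u : ℝ → V) (r : ℝ) : V := (r ^ (s - 1) : ℝ) • gaussAvg s u (4 * r)⁻¹

/-- The derivative of `heatAvg`. -/
def heatAvgDeriv (s : ℝ) (u : ℝ → V) (r : ℝ) : V :=
  (r ^ (s - 1) : ℝ) • ((-4 / (4 * r) ^ 2 : ℝ) • -gaussMoment s u (4 * r)⁻¹)
    + ((s - 1) * r ^ (s - 1 - 1) : ℝ) • gaussAvg s u (4 * r)⁻¹

theorem hasDerivAt_heatAvg (hs1 : s < 1)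
    (hu : MemLp (fun t : ℝ => (t ^ (1 / 2 - s) : ℝ) • u t) 2 ν₊) {r : ℝ} (hr : 0 < r) :
    HasDerivAt (heatAvg s u) (heatAvgDeriv s u r) r := by
  have h1 : HasDerivAt (fun r : ℝ => (4 * r)⁻¹) (-4 / (4 * r) ^ 2) r := by
    have h := ((hasDerivAt_id r).const_mul 4).inv (show (4 : ℝ) * id r ≠ 0 by simpa using hr.ne')
    rwa [mul_one] at h
  have h2 := (hasDerivAt_gaussAvg hs1 hu (q := (4 * r)⁻¹) (by positivity)).scomp r h1
  exact (Real.hasDerivAt_rpow_const (Or.inl hr.ne')).smul h2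

variable [CompleteSpace V] [CompleteSpace H]

/-- Testing the derivative against `t ^ (2 - 2 s) e ^ (-q t²)`. -/
theorem IsSolution.integral_deriv (hs0 : 0 < s) (hs1 : s < 1) (h : IsSolution i j E s u p x z)
    {q : ℝ} (hq : 0 < q) :
    i ((2 - 2 * s) • gaussAvg s u q - (2 * q) • gaussMoment s u q)
      = -∫ t in Ioi (0 : ℝ), (t ^ (2 - 2 * s) * Real.exp (-(q * t ^ 2))) • p t := by
  obtain ⟨C, -, hC⟩ := exists_primitiveBound (by linarith) h.memLp_deriv
  have hg (b : ℝ) (hb : -1 < b) := integrable_rpow_mul_gauss hb hq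
  have hI : Integrable (fun t : ℝ => (2 - 2 * s) * (t ^ (1 - 2 * s) * Real.exp (-(q * t ^ 2)))
      - (2 * q) * (t ^ (3 - 2 * s) * Real.exp (-(q * t ^ 2)))) ν₊ :=
    ((hg _ (by linarith)).const_mul _).sub ((hg _ (by linarith)).const_mul _)
  have hIγ : Integrable (fun t : ℝ => t ^ (1 / 2 - (1 / 2 - s)) *
      ‖(2 - 2 * s) * (t ^ (1 - 2 * s) * Real.exp (-(q * t ^ 2)))
      - (2 * q) * (t ^ (3 - 2 * s) * Real.exp (-(q * t ^ 2)))‖) ν₊ := by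
    have h1 : Integrable (fun t : ℝ => (2 - 2 * s) * (t ^ (1 - s) * Real.exp (-(q * t ^ 2)))
      - (2 * q) * (t ^ (3 - s) * Real.exp (-(q * t ^ 2)))) ν₊ :=
      ((hg _ (by linarith)).const_mul _).sub ((hg _ (by linarith)).const_mul _)
    refine h1.norm.congr ?_
    filter_upwards [ae_pos] with t ht
    rw [show 1 / 2 - (1 / 2 - s) = s by ring]
    nth_rewrite 1 [← Real.norm_of_nonneg (Real.rpow_nonneg ht.le s)]
    rw [← norm_mul, show 1 - s = s + (1 - 2 * s) by ring, show 3 - s = s + (3 - 2 * s) by ring,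
      Real.rpow_add ht, Real.rpow_add ht]
    congr 1
    ring
  have h0 : ContinuousWithinAt (fun t : ℝ => t ^ (2 - 2 * s) * Real.exp (-(q * t ^ 2)))
      (Ici 0) 0 := by
    refine ContinuousAt.continuousWithinAt (ContinuousAt.mul ?_ (by fun_prop))
    exact Real.continuousAt_rpow_const _ _ (Or.inr (by linarith))
  have hd (t : ℝ) (ht : 0 < t) : HasDerivAt (fun t : ℝ => t ^ (2 - 2 * s) * Real.exp (-(q * t ^ 2)))
      ((2 - 2 * s) * (t ^ (1 - 2 * s) * Real.exp (-(q * t ^ 2)))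
      - (2 * q) * (t ^ (3 - 2 * s) * Real.exp (-(q * t ^ 2)))) t := by
    refine ((Real.hasDerivAt_rpow_const (p := 2 - 2 * s) (Or.inl ht.ne')).mul
      (hasDerivAt_gauss q t)).congr_deriv ?_
    rw [show 2 - 2 * s - 1 = 1 - 2 * s by ring, show 3 - 2 * s = 2 - 2 * s + 1 by ring,
      Real.rpow_add_one ht.ne']
    ring
  have key := integral_deriv_smul_eq h0 hd (tendsto_rpow_mul_gauss _ hq) hI hIγ hC h.eq_primitive
  rw [Real.zero_rpow (by linarith)] at key
  simp only [zero_mul, zero_smul, neg_zero, zero_sub] at key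
  rw [← key]
  have i1 := (integrable_gaussAvg hs1 h.memLp hq).smul (2 - 2 * s)
  have i2 := (integrable_gaussMoment hs1 h.memLp hq).smul (2 * q)
  have e : (2 - 2 * s) • gaussAvg s u q - (2 * q) • gaussMoment s u q
      = ∫ t in Ioi (0 : ℝ), ((2 - 2 * s) * (t ^ (1 - 2 * s) * Real.exp (-(q * t ^ 2)))
      - (2 * q) * (t ^ (3 - 2 * s) * Real.exp (-(q * t ^ 2)))) • u t := by
    rw [gaussAvg, gaussMoment, ← integral_smul, ← integral_smul]
    refine (integral_sub i1 i2).symm.trans (integral_congr_ae ?_)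
    filter_upwards [ae_pos] with t ht
    simp only [Pi.smul_apply, smul_smul, ← sub_smul]
    rw [show 3 - 2 * s = 1 - 2 * s + 2 by ring, Real.rpow_add ht, Real.rpow_two]
  have i3 : Integrable (fun t : ℝ => ((2 - 2 * s) * (t ^ (1 - 2 * s) * Real.exp (-(q * t ^ 2)))
      - (2 * q) * (t ^ (3 - 2 * s) * Real.exp (-(q * t ^ 2)))) • u t) ν₊ := by
    refine (i1.sub i2).congr ?_
    filter_upwards [ae_pos] with t ht
    simp only [Pi.smul_apply, Pi.sub_apply, smul_smul, ← sub_smul]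
    rw [show 3 - 2 * s = 1 - 2 * s + 2 by ring, Real.rpow_add ht, Real.rpow_two]
  rw [e]
  refine ((i.restrictScalars ℝ).integral_comp_comm i3).symm.trans ?_
  congr 1
  ext t
  exact (i.restrictScalars ℝ).map_smul _ _

/-- The Gaussian averages of a solution satisfy an ordinary differential equation in `V'`. -/
theorem IsSolution.gaussAvg_ode [CompleteSpace X] (hs0 : 0 < s) (hs1 : s < 1)
    (h : IsSolution i j E s u p x z)
    {q : ℝ} (hq : 0 < q) :
    E (gaussAvg s u q) + (2 * q) • j
      (i ((2 - 2 * s) • gaussAvg s u q - (2 * q) • gaussMoment s u q)) = j z := by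
  rw [h.integral_deriv hs0 hs1 hq]
  have hw := memLp_rpow_smul_form (E := E) h.memLp
  obtain ⟨C, -, hC⟩ := exists_primitiveBound (by linarith) hw
  have hg (b : ℝ) (hb : -1 < b) := integrable_rpow_mul_gauss hb hq
  have hI : Integrable (fun t : ℝ => -(2 * q) * (t * Real.exp (-(q * t ^ 2)))) ν₊ := by
    simpa using (hg 1 (by norm_num)).const_mul (-(2 * q))
  have hIγ : Integrable (fun t : ℝ => t ^ (1 / 2 - (s - 1 / 2)) *
      ‖-(2 * q) * (t * Real.exp (-(q * t ^ 2)))‖) ν₊ := by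
    refine ((hg (1 / 2 - (s - 1 / 2) + 1) (by linarith)).const_mul (2 * q)).congr ?_
    filter_upwards [ae_pos] with t ht
    rw [Real.rpow_add_one ht.ne', norm_mul, norm_neg, Real.norm_of_nonneg (by positivity),
      Real.norm_of_nonneg (by positivity)]
    ring
  have key := integral_deriv_smul_eq (ψ := fun t : ℝ => Real.exp (-(q * t ^ 2)))
    (by fun_prop) (fun t _ => hasDerivAt_gauss q t)
    (by simpa using tendsto_rpow_mul_gauss 0 hq) hI hIγ hC h.conormal_eq
  have e1 : ∫ t in Ioi (0 : ℝ), Real.exp (-(q * t ^ 2)) • (t ^ (1 - 2 * s) : ℝ) • E (u t)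
      = E (gaussAvg s u q) := by
    rw [gaussAvg]
    refine Eq.trans ?_ ((E.restrictScalars ℝ).integral_comp_comm
      (integrable_gaussAvg hs1 h.memLp hq))
    congr 1
    ext1 t
    rw [smul_smul, mul_comm]
    exact ((E.restrictScalars ℝ).map_smul _ _).symm
  have i1 : Integrable (fun t : ℝ => (t ^ (2 - 2 * s) * Real.exp (-(q * t ^ 2))) • p t) ν₊ :=
    integrable_gauss_smul h.memLp_deriv hq (by linarith)
  have e2 : ∫ t in Ioi (0 : ℝ), (-(2 * q) * (t * Real.exp (-(q * t ^ 2)))) •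
      j ((t ^ (1 - 2 * s) : ℝ) • p t)
      = -((2 * q) • j (∫ t in Ioi (0 : ℝ),
        (t ^ (2 - 2 * s) * Real.exp (-(q * t ^ 2))) • p t)) := by
    rw [← neg_smul]
    have := (j.restrictScalars ℝ).integral_comp_comm i1
    simp only [ContinuousLinearMap.coe_restrictScalars'] at this
    rw [← this, ← integral_smul]
    refine integral_congr_ae ?_
    filter_upwards [ae_pos] with t ht
    have hm (c : ℝ) (y : H) : j (c • y) = c • j y :=
      (j.restrictScalars ℝ).map_smul c y
    rw [hm, hm, smul_smul, smul_smul, show 2 - 2 * s = 1 - 2 * s + 1 by ring,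
      Real.rpow_add_one ht.ne']
    congr 1
    ring
  rw [e1, e2] at key
  simp only [ne_eq, OfNat.ofNat_ne_zero, not_false_eq_true, zero_pow, mul_zero, neg_zero,
    Real.exp_zero, one_smul, neg_neg] at key
  rw [map_neg, smul_neg, key]
  abel

/-- The Gaussian averages concentrate at the initial value: since `‖u(t) - x‖ ≤ C t ^ s` in `H`, the
average of `u` differs from that of the constant `x` by a term of lower order as `q → ∞`. -/
theorem IsSolution.norm_gaussAvg_sub_le (hs0 : 0 < s) (hs1 : s < 1)
    (h : IsSolution i j E s u p x z) : ∃ C, 0 ≤ C ∧ ∀ q : ℝ, 0 < q →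
      ‖i (gaussAvg s u q) - (Real.Gamma (1 - s) / 2 * q ^ (s - 1)) • x‖ ≤ C * q ^ (s / 2 - 1) := by
  obtain ⟨C, hC0, hC⟩ := exists_primitiveBound (by linarith) h.memLp_deriv
  rw [show 1 / 2 - (1 / 2 - s) = s by ring] at hC
  have hΓ : 0 < Real.Gamma (1 - s / 2) := Real.Gamma_pos_of_pos (by linarith)
  refine ⟨C * (Real.Gamma (1 - s / 2) / 2), by positivity, fun q hq => ?_⟩
  have i0 := integrable_gaussAvg hs1 h.memLp hq
  have i1 := (integrable_rpow_mul_gauss (b := 1 - 2 * s) (by linarith) hq).smul_const x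
  have e1 : ∫ t in Ioi (0 : ℝ), (t ^ (1 - 2 * s) * Real.exp (-(q * t ^ 2))) • x
      = (Real.Gamma (1 - s) / 2 * q ^ (s - 1)) • x := by
    rw [integral_smul_const, integral_rpow_mul_gauss (by linarith) hq]
    congr 3
    · congr 1; ring
    · ring
  have e2 := (i.restrictScalars ℝ).integral_comp_comm i0
  have i2 := (i.restrictScalars ℝ).integrable_comp i0
  simp only [ContinuousLinearMap.coe_restrictScalars'] at e2 i2
  rw [gaussAvg, ← e2, ← e1, ← integral_sub i2 i1]
  have hb : C * (Real.Gamma (1 - s / 2) / 2) * q ^ (s / 2 - 1)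
      = ∫ t in Ioi (0 : ℝ), C * (t ^ (1 - s) * Real.exp (-(q * t ^ 2))) := by
    rw [integral_const_mul, integral_rpow_mul_gauss (by linarith) hq, mul_assoc]
    congr 3
    · congr 1; ring
    · ring
  rw [hb]
  refine norm_integral_le_of_norm_le
    ((integrable_rpow_mul_gauss (by linarith) hq).const_mul C) ?_
  filter_upwards [ae_pos, h.eq_primitive] with t ht hx
  have hm : i ((t ^ (1 - 2 * s) * Real.exp (-(q * t ^ 2))) • u t)
      = (t ^ (1 - 2 * s) * Real.exp (-(q * t ^ 2))) • i (u t) :=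
    (i.restrictScalars ℝ).map_smul _ _
  rw [hm, ← smul_sub, hx, add_sub_cancel_left, norm_smul, Real.norm_of_nonneg (by positivity)]
  calc _ ≤ t ^ (1 - 2 * s) * Real.exp (-(q * t ^ 2)) * (C * t ^ s) := by
        gcongr
        exact hC.norm_le ht
    _ = _ := by
      rw [show 1 - s = 1 - 2 * s + s by ring, Real.rpow_add ht]
      ring

end Identification

/-! ### The backward equation and the Laplace transform of the resolvent -/

theorem norm_exp_smul_le {X : Type*} [NormedAddCommGroup X] [NormedSpace ℂ X] {r l : ℝ}
    (hr : 0 < r) (hl : 0 < l) (y : X) : ‖Real.exp (-(r * l)) • y‖ ≤ ‖y‖ := by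
  rw [norm_smul, Real.norm_eq_abs, Real.abs_exp]
  exact mul_le_of_le_one_left (norm_nonneg _) (Real.exp_le_one_iff.2 (by nlinarith))

section Resolvent

variable {V H : Type*} [NormedAddCommGroup V] [InnerProductSpace ℂ V] [CompleteSpace V]
  [NormedAddCommGroup H] [InnerProductSpace ℂ H] [CompleteSpace H]
  {i : V →L[ℂ] H} {E : V →L[ℂ] V →L⋆[ℂ] ℂ} {μ s : ℝ}

/-- The Laplace transform `∫ l ^ (-s) e ^ (-r l) (l + A)⁻¹ z dl` of the weighted resolvent. -/
def resolventAvg (i : V →L[ℂ] H) (E : V →L[ℂ] V →L⋆[ℂ] ℂ) (s : ℝ) (z : H) (r : ℝ) : V :=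
  ∫ l in Ioi (0 : ℝ), (l ^ (-s) * Real.exp (-(r * l))) • formResolvent i E l z

/-- The integral `∫ l ^ (1 - s) e ^ (-r l) (l + A)⁻¹ z dl`. -/
def resolventMoment (i : V →L[ℂ] H) (E : V →L[ℂ] V →L⋆[ℂ] ℂ) (s : ℝ) (z : H) (r : ℝ) : V :=
  ∫ l in Ioi (0 : ℝ), (l ^ (-s) * l * Real.exp (-(r * l))) • formResolvent i E l z

theorem integrable_rpow_mul_exp {b r : ℝ} (hb : -1 < b) (hr : 0 < r) :
    Integrable (fun l : ℝ => l ^ b * Real.exp (-(r * l))) ν₊ := by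
  have h := integrableOn_rpow_mul_exp_neg_mul_rpow (p := 1) hb one_pos hr
  simpa [IntegrableOn] using h

theorem aestronglyMeasurable_formResolvent (hμ : 0 < μ) (hE : ∀ u : V, μ * ‖u‖ ^ 2 ≤ (E u u).re)
    (z : H) : AEStronglyMeasurable (fun l => formResolvent i E l z) ν₊ := by
  have h := (continuousOn_formResolvent (i := i) hμ hE).clm_apply (continuousOn_const (c := z))
  exact (h.mono Ioi_subset_Ici_self).aestronglyMeasurable measurableSet_Ioi

theorem integrable_smul_formResolvent (hμ : 0 < μ) (hE : ∀ u : V, μ * ‖u‖ ^ 2 ≤ (E u u).re)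
    (z : H) {k : ℝ → ℝ} (hk : Integrable k ν₊) :
    Integrable (fun l => k l • formResolvent i E l z) ν₊ := by
  refine (hk.norm.mul_const (‖i‖ / μ * ‖z‖)).mono'
    (hk.1.smul (aestronglyMeasurable_formResolvent hμ hE z)) ?_
  filter_upwards [ae_pos] with l hl
  rw [norm_smul]
  gcongr
  exact ContinuousLinearMap.le_of_opNorm_le _ (norm_formResolvent_le hμ hE hl.le) z

theorem integrable_resolventAvg (hs1 : s < 1) (hμ : 0 < μ)
    (hE : ∀ u : V, μ * ‖u‖ ^ 2 ≤ (E u u).re) (z : H) {r : ℝ} (hr : 0 < r) :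
    Integrable (fun l : ℝ => (l ^ (-s) * Real.exp (-(r * l))) • formResolvent i E l z) ν₊ :=
  integrable_smul_formResolvent hμ hE z (integrable_rpow_mul_exp (by linarith) hr)

theorem integrable_resolventMoment (hs1 : s < 1) (hμ : 0 < μ)
    (hE : ∀ u : V, μ * ‖u‖ ^ 2 ≤ (E u u).re) (z : H) {r : ℝ} (hr : 0 < r) :
    Integrable (fun l : ℝ => (l ^ (-s) * l * Real.exp (-(r * l))) • formResolvent i E l z) ν₊ := by
  refine integrable_smul_formResolvent hμ hE z
    ((integrable_rpow_mul_exp (b := -s + 1) (by linarith) hr).congr ?_)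
  filter_upwards [ae_pos] with l hl
  rw [Real.rpow_add_one hl.ne']

theorem hasDerivAt_resolventAvg (hs1 : s < 1) (hμ : 0 < μ)
    (hE : ∀ u : V, μ * ‖u‖ ^ 2 ≤ (E u u).re) (z : H) {r : ℝ} (hr : 0 < r) :
    HasDerivAt (resolventAvg i E s z) (-resolventMoment i E s z r) r :=
  hasDerivAt_integral_exp_smul (κ := fun l => l ^ (-s)) (m := fun l => l)
    (fun _ h => h.le) (fun _ hr => integrable_resolventAvg hs1 hμ hE z hr)
    (fun _ hr => integrable_resolventMoment hs1 hμ hE z hr) hr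

/-- The Laplace transform `h` of the weighted resolvent solves
`h' = 𝒜 h - Γ(1 - s) r ^ (s - 1) z`: its derivative is `-resolventMoment`, and
`l (l + A)⁻¹ = 1 - A (l + A)⁻¹`. -/
theorem resolventAvg_ode (hs1 : s < 1) (hμ : 0 < μ)
    (hE : ∀ u : V, μ * ‖u‖ ^ 2 ≤ (E u u).re) (z : H) {r : ℝ} (hr : 0 < r) (v : V) :
    E (resolventAvg i E s z r) v + gelfand i (i (resolventMoment i E s z r)) v
      = (Real.Gamma (1 - s) * r ^ (s - 1) : ℝ) • gelfand i z v := by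
  have h0 := integrable_resolventAvg (i := i) hs1 hμ hE z hr
  have h1 := integrable_resolventMoment (i := i) hs1 hμ hE z hr
  -- Both functionals are complex linear on `V`, hence commute with the integrals.
  let S : V →L[ℂ] ℂ := E.flip v
  let T : V →L[ℂ] ℂ := (gelfand i).flip v ∘L i
  have e1 : E (resolventAvg i E s z r) v = ∫ l in Ioi (0 : ℝ),
      S ((l ^ (-s) * Real.exp (-(r * l))) • formResolvent i E l z) :=
    (S.integral_comp_comm h0).symm
  have e2 : gelfand i (i (resolventMoment i E s z r)) v = ∫ l in Ioi (0 : ℝ),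
      T ((l ^ (-s) * l * Real.exp (-(r * l))) • formResolvent i E l z) :=
    (T.integral_comp_comm h1).symm
  have e3 : Real.Gamma (1 - s) * r ^ (s - 1)
      = ∫ l in Ioi (0 : ℝ), l ^ (-s) * Real.exp (-(r * l)) := by
    have := Real.integral_rpow_mul_exp_neg_mul_Ioi (a := 1 - s) (by linarith) hr
    rw [show 1 - s - 1 = -s by ring] at this
    rw [this, one_div, Real.inv_rpow hr.le, ← Real.rpow_neg hr.le, neg_sub]
    ring
  rw [e1, e2, e3, ← integral_smul_const,
    ← integral_add (S.integrable_comp h0) (T.integrable_comp h1)]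
  refine integral_congr_ae ?_
  filter_upwards [ae_pos] with l hl
  have hm (L : V →L[ℂ] ℂ) (c : ℝ) (y : V) : L (c • y) = c • L y :=
    (L.restrictScalars ℝ).map_smul c y
  have hspec := congrArg (fun f => f v) (formResolvent_spec (i := i) hμ hE hl.le z)
  simp only [add_apply, smul_apply, smul_eq_mul] at hspec
  rw [hm, hm, ← hspec]
  have hS : S (formResolvent i E l z) = E (formResolvent i E l z) v := rfl
  have hT : T (formResolvent i E l z) = gelfand i (i (formResolvent i E l z)) v := rfl
  rw [hS, hT]
  simp only [Complex.real_smul]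
  push_cast
  ring

theorem integrable_rpow_smul_comp_formResolvent_apply (hμ : 0 < μ)
    (hE : ∀ u : V, μ * ‖u‖ ^ 2 ≤ (E u u).re) (hs0 : 0 < s) (hs1 : s < 1) (z : H) :
    Integrable (fun l : ℝ => (l ^ (-s) : ℝ) • i (formResolvent i E l z)) ν₊ :=
  (integrableOn_rpow_smul_comp_formResolvent (i := i) hμ hE hs0 hs1).apply_continuousLinearMap z

theorem map_resolventAvg (hs1 : s < 1) (hμ : 0 < μ)
    (hE : ∀ u : V, μ * ‖u‖ ^ 2 ≤ (E u u).re) (z : H) {r : ℝ} (hr : 0 < r) :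
    i (resolventAvg i E s z r) = ∫ l in Ioi (0 : ℝ),
      Real.exp (-(r * l)) • (l ^ (-s) : ℝ) • i (formResolvent i E l z) := by
  refine ((i.restrictScalars ℝ).integral_comp_comm
    (integrable_resolventAvg hs1 hμ hE z hr)).symm.trans ?_
  congr 1
  ext1 l
  rw [smul_smul, mul_comm (Real.exp _)]
  exact (i.restrictScalars ℝ).map_smul _ _

theorem norm_map_resolventAvg_le (hμ : 0 < μ)
    (hE : ∀ u : V, μ * ‖u‖ ^ 2 ≤ (E u u).re) (hs0 : 0 < s) (hs1 : s < 1) (z : H) {r : ℝ}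
    (hr : 0 < r) : ‖i (resolventAvg i E s z r)‖ ≤
      ∫ l in Ioi (0 : ℝ), ‖(l ^ (-s) : ℝ) • i (formResolvent i E l z)‖ := by
  rw [map_resolventAvg hs1 hμ hE z hr]
  refine norm_integral_le_of_norm_le
    (integrable_rpow_smul_comp_formResolvent_apply hμ hE hs0 hs1 z).norm ?_
  filter_upwards [ae_pos] with l hl
  exact norm_exp_smul_le hr hl _

theorem tendsto_map_resolventAvg (hμ : 0 < μ)
    (hE : ∀ u : V, μ * ‖u‖ ^ 2 ≤ (E u u).re) (hs0 : 0 < s) (hs1 : s < 1) (z : H) :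
    Tendsto (fun r => i (resolventAvg i E s z r)) (𝓝[>] 0)
      (𝓝 (∫ l in Ioi (0 : ℝ), (l ^ (-s) : ℝ) • i (formResolvent i E l z))) := by
  have hint := integrable_rpow_smul_comp_formResolvent_apply (i := i) hμ hE hs0 hs1 z
  have h : Tendsto (fun r : ℝ => ∫ l in Ioi (0 : ℝ),
      Real.exp (-(r * l)) • (l ^ (-s) : ℝ) • i (formResolvent i E l z)) (𝓝[>] 0)
      (𝓝 (∫ l in Ioi (0 : ℝ), (l ^ (-s) : ℝ) • i (formResolvent i E l z))) := by
    refine tendsto_integral_filter_of_dominated_convergence _ ?_ ?_ hint.norm ?_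
    · refine Eventually.of_forall fun r => AEStronglyMeasurable.smul (𝕜 := ℝ) ?_ hint.1
      exact (by fun_prop : Continuous fun l : ℝ => Real.exp (-(r * l))).aestronglyMeasurable
    · filter_upwards [self_mem_nhdsWithin] with r hr
      filter_upwards [ae_pos] with l hl
      exact norm_exp_smul_le hr hl _
    · refine Eventually.of_forall fun l => ?_
      have hc : Continuous fun r : ℝ =>
          Real.exp (-(r * l)) • (l ^ (-s) : ℝ) • i (formResolvent i E l z) := by fun_prop
      have := (hc.tendsto 0).mono_left (nhdsWithin_le_nhds (s := Ioi 0))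
      simpa using this
  refine h.congr' ?_
  filter_upwards [self_mem_nhdsWithin] with r hr
  exact (map_resolventAvg hs1 hμ hE z hr).symm

end Resolvent

section Identification

variable {V H : Type*} [NormedAddCommGroup V] [InnerProductSpace ℂ V] [CompleteSpace V]
  [NormedAddCommGroup H] [InnerProductSpace ℂ H] [CompleteSpace H]
  {i : V →L[ℂ] H} {E : V →L[ℂ] V →L⋆[ℂ] ℂ} {μ s : ℝ} {u : ℝ → V} {p : ℝ → H} {x z : H}

/-- The heat average `g` of a solution solves `g' = 𝒜 g - r ^ (s - 1) z`. -/
theorem IsSolution.heatAvg_ode (hs0 : 0 < s) (hs1 : s < 1)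
    (h : IsSolution i (gelfand i) E s u p x z) {r : ℝ} (hr : 0 < r) (v : V) :
    gelfand i (i (heatAvgDeriv s u r)) v
      = E (heatAvg s u r) v - (r ^ (s - 1) : ℝ) • gelfand i z v := by
  have h1 := congrArg (fun f => f v) (h.gaussAvg_ode hs0 hs1 (q := (4 * r)⁻¹) (by positivity))
  let S : V →L[ℂ] ℂ := E.flip v
  let T : V →L[ℂ] ℂ := (gelfand i).flip v ∘L i
  have hm (L : V →L[ℂ] ℂ) (c : ℝ) (y : V) : L (c • y) = (c : ℂ) * L y :=
    (L.restrictScalars ℝ).map_smul c y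
  have h2 : S (gaussAvg s u (4 * r)⁻¹) + ((2 * (4 * r)⁻¹ : ℝ) : ℂ) *
      T ((2 - 2 * s) • gaussAvg s u (4 * r)⁻¹ - (2 * (4 * r)⁻¹) • gaussMoment s u (4 * r)⁻¹)
      = gelfand i z v := h1
  rw [map_sub, hm, hm] at h2
  have h3 : T (heatAvgDeriv s u r)
      = S (heatAvg s u r) - ((r ^ (s - 1) : ℝ) : ℂ) * gelfand i z v := by
    have hr' : (r : ℂ) ≠ 0 := by exact_mod_cast hr.ne'
    rw [heatAvgDeriv, heatAvg, map_add, hm, hm, hm, hm, map_neg, ← h2,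
      Real.rpow_sub_one hr.ne' (s - 1)]
    push_cast
    field_simp
    ring
  exact h3

/-- The heat averages tend to `2 ^ (1 - 2 s) Γ(1 - s) x` as `r ↓ 0`, and have moderate growth at
infinity. -/
theorem IsSolution.norm_heatAvg_sub_le (hs0 : 0 < s) (hs1 : s < 1)
    (h : IsSolution i (gelfand i) E s u p x z) : ∃ C, 0 ≤ C ∧ ∀ r : ℝ, 0 < r →
      ‖i (heatAvg s u r) - (2 ^ (1 - 2 * s) * Real.Gamma (1 - s)) • x‖ ≤ C * r ^ (s / 2) := by
  obtain ⟨C, hC0, hC⟩ := h.norm_gaussAvg_sub_le hs0 hs1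
  refine ⟨C * 4 ^ (1 - s / 2), by positivity, fun r hr => ?_⟩
  have h1 := hC (4 * r)⁻¹ (by positivity)
  have hi : i (heatAvg s u r) = (r ^ (s - 1) : ℝ) • i (gaussAvg s u (4 * r)⁻¹) :=
    (i.restrictScalars ℝ).map_smul _ _
  have hc : 2 ^ (1 - 2 * s) * Real.Gamma (1 - s)
      = r ^ (s - 1) * (Real.Gamma (1 - s) / 2 * (4 * r)⁻¹ ^ (s - 1)) := by
    rw [Real.inv_rpow (by positivity), Real.mul_rpow (by norm_num) hr.le,
      show (4 : ℝ) = 2 ^ (2 : ℝ) by norm_num, ← Real.rpow_mul (by norm_num),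
      show 1 - 2 * s = -(2 * (s - 1)) - 1 by ring, Real.rpow_sub_one (by norm_num),
      Real.rpow_neg (by norm_num)]
    have : r ^ (s - 1) ≠ 0 := by positivity
    field_simp
  rw [hi, hc, mul_smul, ← smul_sub, norm_smul, Real.norm_of_nonneg (by positivity)]
  calc _ ≤ r ^ (s - 1) * (C * (4 * r)⁻¹ ^ (s / 2 - 1)) := by gcongr
    _ = _ := by
      rw [Real.inv_rpow (by positivity), ← Real.rpow_neg (by positivity),
        Real.mul_rpow (by norm_num) hr.le, show s / 2 = s - 1 + -(s / 2 - 1) by ring,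
        Real.rpow_add hr]
      rw [show -(s - 1 + -(s / 2 - 1) - 1) = 1 - s / 2 by ring,
        show 1 - (s - 1 + -(s / 2 - 1)) = 1 - s / 2 by ring,
        show -(s / 2 - 1) = 1 - s / 2 by ring]
      ring

/-- The initial value of a solution with conormal derivative `z` is `c_s⁻¹ A ^ (-s) z`: its heat
averages and the Laplace transform of the resolvent solve the same backward equation. -/
theorem IsSolution.negFracPow_eq (hi : Function.Injective i) (hd : DenseRange i) (hμ : 0 < μ)
    (hE : ∀ u : V, μ * ‖u‖ ^ 2 ≤ (E u u).re) (hs0 : 0 < s) (hs1 : s < 1)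
    (h : IsSolution i (gelfand i) E s u p x z) :
    negFracPow (formOp i E) s z = dtnConst s • x := by
  have hΓ1 : 0 < Real.Gamma (1 - s) := Real.Gamma_pos_of_pos (by linarith)
  have hΓ : 0 < Real.Gamma s := Real.Gamma_pos_of_pos hs0
  obtain ⟨C, hC0, hC⟩ := h.norm_heatAvg_sub_le hs0 hs1
  set G : ℝ := Real.Gamma (1 - s) with hG
  set c₀ : ℝ := 2 ^ (1 - 2 * s) * G with hc₀
  set D : ℝ := ∫ l in Ioi (0 : ℝ), ‖(l ^ (-s) : ℝ) • i (formResolvent i E l z)‖ with hD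
  have hD0 : 0 ≤ D := integral_nonneg fun _ => norm_nonneg _
  have hmi (c : ℝ) (y : V) : i (c • y) = c • i y := (i.restrictScalars ℝ).map_smul c y
  -- The heat average and the normalised Laplace transform coincide.
  have hzero (r : ℝ) (hr : 0 < r) : i (heatAvg s u r - G⁻¹ • resolventAvg i E s z r) = 0 := by
    refine eq_zero_of_backward (C := ‖c₀ • x‖ + C + G⁻¹ * D) hμ hE
      (w := fun r => heatAvg s u r - G⁻¹ • resolventAvg i E s z r)
      (fun r hr => (hasDerivAt_heatAvg hs1 h.memLp hr).sub
        ((hasDerivAt_resolventAvg hs1 hμ hE z hr).const_smul G⁻¹)) (fun r hr => ?_)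
      (fun r hr => ?_) hr
    · ext v
      have e1 := h.heatAvg_ode hs0 hs1 hr v
      have e2 := resolventAvg_ode (i := i) hs1 hμ hE z hr v
      let S : V →L[ℂ] ℂ := E.flip v
      let T : V →L[ℂ] ℂ := (gelfand i).flip v ∘L i
      have hm (L : V →L[ℂ] ℂ) (c : ℝ) (y : V) : L (c • y) = (c : ℂ) * L y :=
        (L.restrictScalars ℝ).map_smul c y
      replace e1 : T (heatAvgDeriv s u r) = S (heatAvg s u r)
        - ((r ^ (s - 1) : ℝ) : ℂ) * gelfand i z v := e1
      replace e2 : S (resolventAvg i E s z r) + T (resolventMoment i E s z r)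
        = ((G * r ^ (s - 1) : ℝ) : ℂ) * gelfand i z v := e2
      change T (heatAvgDeriv s u r - G⁻¹ • -resolventMoment i E s z r)
        = S (heatAvg s u r - G⁻¹ • resolventAvg i E s z r)
      rw [map_sub, map_sub, hm, hm, map_neg, e1]
      have hG' : (G : ℂ) ≠ 0 := by exact_mod_cast hΓ1.ne'
      push_cast at e2 ⊢
      field_simp
      linear_combination e2
    · have hrs : r ^ (s / 2) ≤ 1 + r := by
        rcases le_total r 1 with h1 | h1
        · exact (Real.rpow_le_one hr.le h1 (by linarith)).trans (by linarith)
        · exact (Real.rpow_le_rpow_of_exponent_le h1 (by linarith : s / 2 ≤ 1)).trans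
            (by rw [Real.rpow_one]; linarith)
      have h1 : ‖i (heatAvg s u r)‖ ≤ ‖c₀ • x‖ + C * (1 + r) := by
        calc ‖i (heatAvg s u r)‖ = ‖c₀ • x + (i (heatAvg s u r) - c₀ • x)‖ := by
              rw [add_sub_cancel]
          _ ≤ ‖c₀ • x‖ + ‖i (heatAvg s u r) - c₀ • x‖ := norm_add_le _ _
          _ ≤ _ := by
            gcongr
            exact (hC r hr).trans (by gcongr)
      have h2 := norm_map_resolventAvg_le (i := i) hμ hE hs0 hs1 z hr
      rw [map_sub, hmi]
      calc _ ≤ ‖i (heatAvg s u r)‖ + ‖G⁻¹ • i (resolventAvg i E s z r)‖ := norm_sub_le _ _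
        _ ≤ (‖c₀ • x‖ + C * (1 + r)) + G⁻¹ * D := by
          rw [norm_smul, Real.norm_of_nonneg (by positivity : 0 ≤ G⁻¹)]
          gcongr
        _ ≤ _ := by
          have h3 : 0 ≤ ‖c₀ • x‖ * r := by positivity
          have h4 : 0 ≤ G⁻¹ * D * r := by positivity
          linarith
  have hlim1 : Tendsto (fun r => i (heatAvg s u r)) (𝓝[>] 0) (𝓝 (c₀ • x)) := by
    rw [tendsto_iff_norm_sub_tendsto_zero]
    have h1 : Tendsto (fun r : ℝ => C * r ^ (s / 2)) (𝓝[>] 0) (𝓝 0) := by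
      have := ((Real.continuousAt_rpow_const 0 (s / 2) (Or.inr (by linarith))).tendsto.const_mul
        C).mono_left (nhdsWithin_le_nhds (s := Ioi 0))
      rwa [Real.zero_rpow (by linarith), mul_zero] at this
    refine squeeze_zero' (Eventually.of_forall fun _ => norm_nonneg _) ?_ h1
    filter_upwards [self_mem_nhdsWithin] with r hr
    exact hC r hr
  have hlim2 := (tendsto_map_resolventAvg (i := i) hμ hE hs0 hs1 z).const_smul G⁻¹
  have heq := tendsto_nhds_unique (hlim1.congr' (by
    filter_upwards [self_mem_nhdsWithin] with r hr
    have := hzero r hr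
    rwa [map_sub, hmi, sub_eq_zero] at this)) hlim2
  have hint : ∫ l in Ioi (0 : ℝ), (l ^ (-s) : ℝ) • i (formResolvent i E l z) = (G * c₀) • x := by
    rw [mul_smul, heq, smul_inv_smul₀ hΓ1.ne']
  rw [negFracPow_formOp_apply hi hd hμ hE hs0 hs1, hint, smul_smul, dtnConst]
  congr 1
  -- The constants agree by `Γ(s) Γ(1 - s) = π / sin (π s)`.
  have hrefl := Real.Gamma_mul_Gamma_one_sub s
  rw [← hG] at hrefl ⊢
  have hsin : Real.sin (Real.pi * s) ≠ 0 := by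
    intro h0
    rw [h0, div_zero] at hrefl
    exact (mul_pos hΓ hΓ1).ne' hrefl
  rw [eq_div_iff hsin] at hrefl
  have hpi := Real.pi_ne_zero
  rw [hc₀]
  field_simp
  linear_combination hrefl

end Identification

/-! ### Scalar test functions on the half line -/

section Kernels

theorem memLp_smul_const {X : Type*} [NormedAddCommGroup X] [NormedSpace ℂ X] {k : ℝ → ℂ}
    (hk : MemLp k 2 ν₊) (a : X) : MemLp (fun t => k t • a) 2 ν₊ :=
  (ContinuousLinearMap.toSpanSingleton ℂ a).comp_memLp' hk

theorem memLp_rpow_mul_gauss {b q : ℝ} (hb : -(1 / 2) < b) (hq : 0 < q) :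
    MemLp (fun t : ℝ => t ^ b * Real.exp (-(q * t ^ 2))) 2 ν₊ := by
  rw [memLp_two_iff_integrable_sq (by fun_prop)]
  refine (integrable_rpow_mul_gauss (b := 2 * b) (q := 2 * q) (by linarith) (by linarith)).congr ?_
  filter_upwards [ae_pos] with t ht
  rw [mul_pow, ← Real.rpow_mul_natCast ht.le, ← Real.exp_nat_mul]
  congr 2
  · push_cast; ring
  · push_cast; ring

theorem memLp_rpow_mul_of_hasCompactSupport {g : ℝ → ℂ} (hg : Continuous g)
    (hc : HasCompactSupport g) (hs : tsupport g ⊆ Ioi (0 : ℝ)) (b : ℝ) :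
    MemLp (fun t : ℝ => ((t ^ b : ℝ) : ℂ) * g t) 2 ν₊ := by
  have hm : AEStronglyMeasurable (fun t : ℝ => ((t ^ b : ℝ) : ℂ) * g t) ν₊ := by fun_prop
  rw [memLp_two_iff_integrable_sq_norm hm]
  have hl : MemL1Loc (fun t : ℝ => t ^ (2 * b)) :=
    ContinuousOn.locallyIntegrableOn
      (continuousOn_id.rpow_const fun t ht => Or.inl (ne_of_gt ht)) measurableSet_Ioi
  have hsub : tsupport (fun t => ‖g t‖ ^ 2) ⊆ tsupport g :=
    closure_mono fun t ht h => ht (by simp only; rw [h]; simp)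
  have h := MemL1Loc.integrable_smul hl (φ := fun t => ‖g t‖ ^ 2) (by fun_prop)
    (hc.of_isClosed_subset (isClosed_tsupport _) hsub) (hsub.trans hs)
  refine h.integrableOn.congr ?_
  filter_upwards [ae_pos] with t ht
  rw [norm_mul, mul_pow, Complex.norm_real, Real.norm_of_nonneg (by positivity),
    ← Real.rpow_mul_natCast ht.le, smul_eq_mul, mul_comm b, mul_comm]
  norm_num

theorem PrimitiveBound.memL1Loc {X : Type*} [NormedAddCommGroup X] [NormedSpace ℂ X] {f : ℝ → X}
    {γ C : ℝ} (h : PrimitiveBound f γ C) : MemL1Loc f := fun x hx =>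
  ⟨Ioc 0 (x + 1), by
    rw [← Ioi_inter_Iic]
    exact inter_mem_nhdsWithin _ (Iic_mem_nhds (by linarith)), h.integrableOn (x + 1)⟩

theorem inner_toLp {X : Type*} [NormedAddCommGroup X] [InnerProductSpace ℂ X] {f : ℝ → X}
    (hf : MemLp f 2 ν₊) (g : Lp X 2 ν₊) :
    inner ℂ (hf.toLp f) g = ∫ t in Ioi (0 : ℝ), inner ℂ (f t) (g t) := by
  rw [L2.inner_def]
  refine integral_congr_ae ?_
  filter_upwards [hf.coeFn_toLp] with t ht
  rw [ht]

/-- Scalar functions on the half line that may be multiplied by vectors of `V` to give test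
functions for the Neumann problem. They need not vanish at `0`, and they include both the compactly
supported ones and the Gaussian. -/
structure IsTestFunction (s : ℝ) (ψ : ℝ → ℂ) : Prop where
  contDiff : ContDiff ℝ 1 ψ
  memLp : MemLp (fun t : ℝ => ((t ^ (1 / 2 - s) : ℝ) : ℂ) * ψ t) 2 ν₊
  memLp_deriv : MemLp (fun t : ℝ => ((t ^ (1 / 2 - s) : ℝ) : ℂ) * deriv ψ t) 2 ν₊
  bounded : ∃ C, ∀ t, ‖ψ t‖ ≤ C
  bounded_deriv : ∃ C, ∀ t, ‖deriv ψ t‖ ≤ C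

theorem tsupport_deriv_subset' {φ : ℝ → ℂ} : tsupport (deriv φ) ⊆ tsupport φ :=
  closure_minimal support_deriv_subset (isClosed_tsupport _)

theorem isTestFunction_of_hasCompactSupport {s : ℝ} {φ : ℝ → ℂ} (hφ : ContDiff ℝ 1 φ)
    (hc : HasCompactSupport φ) (hs : tsupport φ ⊆ Ioi (0 : ℝ)) : IsTestFunction s φ where
  contDiff := hφ
  memLp := memLp_rpow_mul_of_hasCompactSupport hφ.continuous hc hs _
  memLp_deriv := memLp_rpow_mul_of_hasCompactSupport (hφ.continuous_deriv le_rfl) hc.deriv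
    (tsupport_deriv_subset'.trans hs) _
  bounded := hc.exists_bound_of_continuous hφ.continuous
  bounded_deriv := hc.deriv.exists_bound_of_continuous (hφ.continuous_deriv le_rfl)

theorem hasDerivAt_ofReal_gauss (t : ℝ) :
    HasDerivAt (fun t : ℝ => ((Real.exp (-(1 * t ^ 2)) : ℝ) : ℂ))
      ((-(2 * 1) * (t * Real.exp (-(1 * t ^ 2))) : ℝ) : ℂ) t := (hasDerivAt_gauss 1 t).ofReal_comp

theorem isTestFunction_gauss {s : ℝ} (hs1 : s < 1) :
    IsTestFunction s fun t : ℝ => ((Real.exp (-(1 * t ^ 2)) : ℝ) : ℂ) where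
  contDiff := by
    exact Complex.ofRealCLM.contDiff.comp
      (by fun_prop : ContDiff ℝ 1 fun t : ℝ => Real.exp (-(1 * t ^ 2)))
  memLp := by
    refine (memLp_rpow_mul_gauss (b := 1 / 2 - s) (by linarith) one_pos).ofReal.ae_eq ?_
    exact Eventually.of_forall fun t => by simp
  memLp_deriv := by
    refine ((memLp_rpow_mul_gauss (b := 1 / 2 - s + 1) (by linarith)
      one_pos).const_mul (-2)).ofReal.ae_eq ?_
    filter_upwards [ae_pos] with t ht
    rw [(hasDerivAt_ofReal_gauss t).deriv, Real.rpow_add_one ht.ne', ← Complex.ofReal_mul]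
    exact congrArg Complex.ofReal (by simp only [Algebra.algebraMap_self, RingHom.id_apply]; ring)
  bounded := ⟨1, fun t => by
    rw [Complex.norm_real, Real.norm_eq_abs, Real.abs_exp, Real.exp_le_one_iff]
    nlinarith [sq_nonneg t]⟩
  bounded_deriv := ⟨1, fun t => by
    rw [(hasDerivAt_ofReal_gauss t).deriv, Complex.norm_real, norm_mul, norm_mul,
      Real.norm_eq_abs (Real.exp _), Real.abs_exp, Real.exp_neg, Real.norm_eq_abs, Real.norm_eq_abs,
      ← mul_assoc, mul_inv_le_iff₀ (Real.exp_pos _), one_mul]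
    refine le_trans ?_ (Real.add_one_le_exp _)
    rw [show |(-(2 * 1) : ℝ)| = 2 by norm_num]
    nlinarith [sq_nonneg (|t| - 1), sq_abs t]⟩

/-- The value `ψ 0` in terms of integrals over the half line, from the fundamental theorem of
calculus for `ψ(t) e ^ (-t²)`. -/
theorem IsTestFunction.integral_eq {s : ℝ} {ψ : ℝ → ℂ} (hψ : IsTestFunction s ψ) :
    (∫ t in Ioi (0 : ℝ), conj (ψ t) * ((2 * t * Real.exp (-(1 * t ^ 2)) : ℝ) : ℂ))
      - ∫ t in Ioi (0 : ℝ), conj (deriv ψ t) * ((Real.exp (-(1 * t ^ 2)) : ℝ) : ℂ)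
      = conj (ψ 0) := by
  obtain ⟨C, hC⟩ := hψ.bounded
  obtain ⟨D, hD⟩ := hψ.bounded_deriv
  have hψc := hψ.contDiff.continuous
  have hψd := hψ.contDiff.continuous_deriv le_rfl
  have hg0 : Integrable (fun t : ℝ => Real.exp (-(1 * t ^ 2))) ν₊ := by
    simpa using integrable_rpow_mul_gauss (b := 0) (q := 1) (by norm_num) one_pos
  have hg1 : Integrable (fun t : ℝ => t * Real.exp (-(1 * t ^ 2))) ν₊ := by
    simpa using integrable_rpow_mul_gauss (b := 1) (q := 1) (by norm_num) one_pos
  have i1 : Integrable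
      (fun t : ℝ => conj (ψ t) * ((2 * t * Real.exp (-(1 * t ^ 2)) : ℝ) : ℂ)) ν₊ := by
    refine (hg1.const_mul (2 * C)).mono' ?_ ?_
    · exact Continuous.aestronglyMeasurable (by fun_prop)
    · filter_upwards [ae_pos] with t ht
      rw [norm_mul, RCLike.norm_conj, Complex.norm_real, Real.norm_of_nonneg (by positivity)]
      calc _ ≤ C * (2 * t * Real.exp (-(1 * t ^ 2))) := by gcongr; exact hC t
        _ = _ := by ring
  have i2 : Integrable
      (fun t : ℝ => conj (deriv ψ t) * ((Real.exp (-(1 * t ^ 2)) : ℝ) : ℂ)) ν₊ := by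
    refine (hg0.const_mul D).mono' ?_ ?_
    · exact Continuous.aestronglyMeasurable (by fun_prop)
    · filter_upwards [ae_pos] with t ht
      rw [norm_mul, RCLike.norm_conj, Complex.norm_real, Real.norm_of_nonneg (by positivity)]
      gcongr
      exact hD t
  have hlim : Tendsto (fun t : ℝ => conj (ψ t) * ((Real.exp (-(1 * t ^ 2)) : ℝ) : ℂ)) atTop
      (𝓝 0) := by
    have h := (tendsto_rpow_mul_gauss 0 (q := 1) one_pos).const_mul C
    simp only [Real.rpow_zero, one_mul, mul_zero] at h
    refine squeeze_zero_norm (fun t => ?_) h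
    rw [norm_mul, RCLike.norm_conj, Complex.norm_real, Real.norm_of_nonneg (by positivity), one_mul]
    gcongr
    exact hC t
  have hd (t : ℝ) : HasDerivAt (fun t : ℝ => conj (ψ t) * ((Real.exp (-(1 * t ^ 2)) : ℝ) : ℂ))
      (conj (deriv ψ t) * ((Real.exp (-(1 * t ^ 2)) : ℝ) : ℂ)
        - conj (ψ t) * ((2 * t * Real.exp (-(1 * t ^ 2)) : ℝ) : ℂ)) t := by
    have h1 := (hψ.contDiff.differentiable one_ne_zero t).hasDerivAt.star
    refine (h1.mul (hasDerivAt_ofReal_gauss t)).congr_deriv ?_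
    simp only [starRingEnd_apply]
    push_cast
    ring
  have key := integral_Ioi_of_hasDerivAt_of_tendsto' (a := 0) (fun t _ => hd t) (i2.sub i1) hlim
  rw [integral_sub i2 i1] at key
  rw [← neg_sub, key]
  simp

end Kernels

/-! ### The weighted Sobolev space as a Hilbert space -/

section Neumann

variable {V H : Type*} [NormedAddCommGroup V] [InnerProductSpace ℂ V]
  [NormedAddCommGroup H] [InnerProductSpace ℂ H]

/-- The Hilbert space of pairs `(t ^ (1 / 2 - s) u, t ^ (1 / 2 - s) u')`. Storing the weighted
functions makes the components square integrable with respect to `dt`, whatever `s` is. -/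
abbrev PairSpace (V H : Type*) [NormedAddCommGroup V] [InnerProductSpace ℂ V]
    [NormedAddCommGroup H] [InnerProductSpace ℂ H] : Type _ :=
  WithLp 2 (Lp V 2 ν₊ × Lp H 2 ν₊)

/-- The element of `PairSpace V H` given by two square integrable functions. -/
def mkPair {f : ℝ → V} {g : ℝ → H} (hf : MemLp f 2 ν₊) (hg : MemLp g 2 ν₊) : PairSpace V H :=
  WithLp.toLp 2 (hf.toLp f, hg.toLp g)

theorem inner_mkPair {f : ℝ → V} {g : ℝ → H} (hf : MemLp f 2 ν₊) (hg : MemLp g 2 ν₊)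
    (k : PairSpace V H) : inner ℂ (mkPair hf hg) k
      = (∫ t in Ioi (0 : ℝ), inner ℂ (f t) (k.fst t))
        + ∫ t in Ioi (0 : ℝ), inner ℂ (g t) (k.snd t) := by
  rw [WithLp.prod_inner_apply]
  exact congrArg₂ (· + ·) (inner_toLp hf _) (inner_toLp hg _)

/-- The operator `(U, P) ↦ (T U, P)` on `PairSpace V H`. For `T = formMap E` it represents the form
`∫ t ^ (1 - 2 s) (E(u, v) + ⟨u', v'⟩) dt`. -/
def pairMap (H : Type*) [NormedAddCommGroup H] [InnerProductSpace ℂ H] (T : V →L[ℂ] V) :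
    PairSpace V H →L[ℂ] PairSpace V H :=
  (WithLp.prodContinuousLinearEquiv 2 ℂ (Lp V 2 ν₊) (Lp H 2 ν₊)).symm.toContinuousLinearMap ∘L
    ((T.compLpL 2 ν₊).prodMap (ContinuousLinearMap.id ℂ (Lp H 2 ν₊))) ∘L
    (WithLp.prodContinuousLinearEquiv 2 ℂ (Lp V 2 ν₊) (Lp H 2 ν₊)).toContinuousLinearMap

theorem pairMap_fst (T : V →L[ℂ] V) (k : PairSpace V H) :
    ((pairMap H T k).fst : ℝ → V) =ᵐ[ν₊] fun t => T (k.fst t) :=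
  T.coeFn_compLpL k.fst

theorem pairMap_snd (T : V →L[ℂ] V) (k : PairSpace V H) : (pairMap H T k).snd = k.snd := rfl

theorem pairMap_coercive {T : V →L[ℂ] V} {μ : ℝ}
    (hT : ∀ v, μ * ‖v‖ ^ 2 ≤ (inner ℂ v (T v)).re) (k : PairSpace V H) :
    min μ 1 * ‖k‖ ^ 2 ≤ (inner ℂ k (pairMap H T k)).re := by
  rw [WithLp.prod_norm_sq_eq_of_L2, WithLp.prod_inner_apply, Complex.add_re]
  have h2 : (inner ℂ k.snd (pairMap H T k).snd).re = ‖k.snd‖ ^ 2 := by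
    rw [pairMap_snd]
    exact inner_self_eq_norm_sq (𝕜 := ℂ) k.snd
  have h1 : μ * ‖k.fst‖ ^ 2 ≤ (inner ℂ k.fst (pairMap H T k).fst).re := by
    have e1 : ‖k.fst‖ ^ 2 = ∫ t in Ioi (0 : ℝ), ‖k.fst t‖ ^ 2 := by
      rw [← inner_self_eq_norm_sq (𝕜 := ℂ), L2.inner_def]
      refine (integral_re (L2.integrable_inner (𝕜 := ℂ) k.fst k.fst)).symm.trans ?_
      refine integral_congr_ae (Eventually.of_forall fun t => ?_)
      exact inner_self_eq_norm_sq (𝕜 := ℂ) (k.fst t)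
    have e2 : (inner ℂ k.fst (pairMap H T k).fst).re
        = ∫ t in Ioi (0 : ℝ), (inner ℂ (k.fst t) ((pairMap H T k).fst t)).re := by
      rw [L2.inner_def]
      exact (integral_re (L2.integrable_inner (𝕜 := ℂ) k.fst (pairMap H T k).fst)).symm
    rw [e1, e2, ← integral_const_mul]
    refine integral_mono_ae ?_ (L2.integrable_inner (𝕜 := ℂ) k.fst (pairMap H T k).fst).re ?_
    · exact ((memLp_two_iff_integrable_sq_norm (Lp.aestronglyMeasurable _)).1
        (Lp.memLp k.fst)).const_mul μ
    · filter_upwards [pairMap_fst T k] with t ht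
      rw [ht]
      exact hT _
  have h3 : min μ 1 * ‖k.fst‖ ^ 2 ≤ μ * ‖k.fst‖ ^ 2 := by gcongr; exact min_le_left _ _
  have h4 : min μ 1 * ‖k.snd‖ ^ 2 ≤ 1 * ‖k.snd‖ ^ 2 := by gcongr; exact min_le_right _ _
  change _ ≤ (inner ℂ k.fst (pairMap H T k).fst).re + (inner ℂ k.snd (pairMap H T k).snd).re
  rw [h2, mul_add]
  linarith

variable [CompleteSpace V] [CompleteSpace H]

/-- The pair representing the functional `(u, u') ↦ ∫ (φ' ⟨u, h⟩ + φ ⟨u', h⟩)` for a test function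
`φ` on the open half line and `h ∈ H`. -/
def weakDerivPair (i : V →L[ℂ] H) (s : ℝ) (φ : {φ : ℝ → ℂ // ContDiff ℝ ∞ φ ∧ HasCompactSupport φ ∧
    tsupport φ ⊆ Ioi (0 : ℝ)}) (h : H) : PairSpace V H :=
  mkPair
    (memLp_smul_const (memLp_rpow_mul_of_hasCompactSupport (g := fun t => conj (deriv φ.1 t))
      (Complex.continuous_conj.comp (φ.2.1.continuous_deriv (by simp)))
      (φ.2.2.1.deriv.comp_left (g := conj) (map_zero _))
      ((tsupport_comp_subset (map_zero _) _).trans (tsupport_deriv_subset'.trans φ.2.2.2))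
      (s - 1 / 2)) (i.adjoint h))
    (memLp_smul_const (memLp_rpow_mul_of_hasCompactSupport (g := fun t => conj (φ.1 t))
      (Complex.continuous_conj.comp φ.2.1.continuous)
      (φ.2.2.1.comp_left (g := conj) (map_zero _))
      ((tsupport_comp_subset (map_zero _) _).trans φ.2.2.2) (s - 1 / 2)) h)

/-- The space `W_{1-s}(H, V)`, as the closed subspace of those pairs whose second component is the
weak derivative of the first one. -/
def sobolevSubmodule (i : V →L[ℂ] H) (s : ℝ) : Submodule ℂ (PairSpace V H) :=
  (Submodule.span ℂ (range fun q : _ × H => weakDerivPair i s q.1 q.2))ᗮ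

theorem mem_sobolevSubmodule_iff {i : V →L[ℂ] H} {s : ℝ} {k : PairSpace V H} :
    k ∈ sobolevSubmodule i s ↔ ∀ φ h, inner ℂ (weakDerivPair i s φ h) k = 0 := by
  rw [sobolevSubmodule, Submodule.mem_orthogonal]
  constructor
  · exact fun hk φ h => hk _ (Submodule.subset_span ⟨(φ, h), rfl⟩)
  · intro hk q hq
    induction hq using Submodule.span_induction with
    | mem q hq => obtain ⟨⟨φ, h⟩, rfl⟩ := hq; exact hk φ h
    | zero => simp
    | add a b _ _ ha hb => rw [inner_add_left, ha, hb, add_zero]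
    | smul c a _ ha => rw [inner_smul_left, ha, mul_zero]

/-- The pair of the function `ψ ⊗ v`. -/
def testPair (i : V →L[ℂ] H) {s : ℝ} {ψ : ℝ → ℂ} (hψ : IsTestFunction s ψ) (v : V) :
    PairSpace V H := mkPair (memLp_smul_const hψ.memLp v) (memLp_smul_const hψ.memLp_deriv (i v))

theorem testPair_mem (i : V →L[ℂ] H) {s : ℝ} {ψ : ℝ → ℂ} (hψ : IsTestFunction s ψ) (v : V) :
    testPair i hψ v ∈ sobolevSubmodule i s := by
  rw [mem_sobolevSubmodule_iff]
  rintro ⟨φ, hφ, hφc, hφs⟩ h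
  have hφ1 : ContDiff ℝ 1 φ := hφ.of_le (by simp)
  rw [weakDerivPair, inner_mkPair]
  have hab {t : ℝ} (ht : 0 < t) : ((t ^ (s - 1 / 2) : ℝ) : ℂ)
      * ((t ^ (1 / 2 - s) : ℝ) : ℂ) = 1 := by
    rw [← Complex.ofReal_mul, ← Real.rpow_add ht]
    simp
  have e1 : ∫ t in Ioi (0 : ℝ),
      inner ℂ ((((t ^ (s - 1 / 2) : ℝ) : ℂ) * conj (deriv φ t)) • i.adjoint h)
      ((testPair i hψ v).fst t) = ∫ t in Ioi (0 : ℝ), (deriv φ t * ψ t) * inner ℂ h (i v) := by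
    refine integral_congr_ae ?_
    filter_upwards [ae_pos, (memLp_smul_const hψ.memLp v).coeFn_toLp] with t ht hv
    have : (testPair i hψ v).fst t = (((t ^ (1 / 2 - s) : ℝ) : ℂ) * ψ t) • v := hv
    rw [this, inner_smul_left, inner_smul_right, ContinuousLinearMap.adjoint_inner_left]
    simp only [map_mul, Complex.conj_ofReal, Complex.conj_conj]
    linear_combination deriv φ t * ψ t * inner ℂ h (i v) * hab ht
  have e2 : ∫ t in Ioi (0 : ℝ), inner ℂ ((((t ^ (s - 1 / 2) : ℝ) : ℂ) * conj (φ t)) • h)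
      ((testPair i hψ v).snd t) = ∫ t in Ioi (0 : ℝ), (φ t * deriv ψ t) * inner ℂ h (i v) := by
    refine integral_congr_ae ?_
    filter_upwards [ae_pos, (memLp_smul_const hψ.memLp_deriv (i v)).coeFn_toLp] with t ht hv
    have : (testPair i hψ v).snd t = (((t ^ (1 / 2 - s) : ℝ) : ℂ) * deriv ψ t) • i v := hv
    rw [this, inner_smul_left, inner_smul_right]
    simp only [map_mul, Complex.conj_ofReal, Complex.conj_conj]
    linear_combination φ t * deriv ψ t * inner ℂ h (i v) * hab ht
  rw [e1, e2, integral_mul_const, integral_mul_const, ← add_mul]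
  have i1 : Integrable (fun t => deriv φ t * ψ t) ν₊ :=
    (Continuous.integrable_of_hasCompactSupport
      ((hφ1.continuous_deriv le_rfl).mul hψ.contDiff.continuous) hφc.deriv.mul_right).integrableOn
  have i2 : Integrable (fun t => φ t * deriv ψ t) ν₊ :=
    (Continuous.integrable_of_hasCompactSupport
      (hφ1.continuous.mul (hψ.contDiff.continuous_deriv le_rfl)) hφc.mul_right).integrableOn
  have hz : (∫ t in Ioi (0 : ℝ), deriv φ t * ψ t) + ∫ t in Ioi (0 : ℝ), φ t * deriv ψ t = 0 := by
    rw [← integral_add i1 i2]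
    have h1 := (hφc.mul_right (f' := ψ)).integral_Ioi_deriv_eq (hφ1.mul hψ.contDiff) 0
    have h0 : φ 0 = 0 := image_eq_zero_of_notMem_tsupport fun h => lt_irrefl (0 : ℝ) (hφs h)
    rw [h0, zero_mul, neg_zero] at h1
    rw [← h1]
    congr 1
    ext t
    exact ((hφ1.differentiable one_ne_zero t).hasDerivAt.mul
      (hψ.contDiff.differentiable one_ne_zero t).hasDerivAt).deriv.symm
  rw [hz, zero_mul]

/-- The pair representing the functional `(u, u') ↦ ⟨u(0), z⟩` on the Sobolev space, through
`u(0) = ∫ 2 t e^{-t²} u dt - ∫ e^{-t²} u' dt`. -/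
def tracePair (i : V →L[ℂ] H) {s : ℝ} (hs0 : 0 < s) (z : H) : PairSpace V H :=
  mkPair
    (memLp_smul_const (memLp_rpow_mul_gauss (b := s + 1 / 2) (by linarith) one_pos).ofReal
      ((2 : ℂ) • i.adjoint z))
    (memLp_smul_const (memLp_rpow_mul_gauss (b := s - 1 / 2) (by linarith) one_pos).ofReal (-z))

theorem inner_testPair_tracePair (i : V →L[ℂ] H) {s : ℝ} (hs0 : 0 < s) (z : H) {ψ : ℝ → ℂ}
    (hψ : IsTestFunction s ψ) (v : V) :
    inner ℂ (testPair i hψ v) (tracePair i hs0 z) = conj (ψ 0) * inner ℂ (i v) z := by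
  rw [testPair, inner_mkPair, ← hψ.integral_eq, sub_mul, ← integral_mul_const,
    ← integral_mul_const]
  have hab (b : ℝ) {t : ℝ} (ht : 0 < t) :
      ((t ^ (1 / 2 - s) : ℝ) : ℂ) * ((t ^ (s + b) : ℝ) : ℂ) = ((t ^ (b + 1 / 2) : ℝ) : ℂ) := by
    rw [← Complex.ofReal_mul, ← Real.rpow_add ht]
    congr 2
    ring
  refine (congrArg₂ (· + ·) ?_ ?_).trans (sub_eq_add_neg _ _).symm
  · refine integral_congr_ae ?_
    filter_upwards [ae_pos, (memLp_smul_const (memLp_rpow_mul_gauss (b := s + 1 / 2) (by linarith)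
      one_pos).ofReal ((2 : ℂ) • i.adjoint z)).coeFn_toLp] with t ht hv
    have : (tracePair i hs0 z).fst t
        = ((t ^ (s + 1 / 2) * Real.exp (-(1 * t ^ 2)) : ℝ) : ℂ) • (2 : ℂ) • i.adjoint z := hv
    rw [this, inner_smul_left, inner_smul_right, inner_smul_right,
      ContinuousLinearMap.adjoint_inner_right]
    have h1 := hab (1 / 2) ht
    rw [show (1 / 2 + 1 / 2 : ℝ) = 1 by norm_num, Real.rpow_one] at h1
    simp only [map_mul, Complex.conj_ofReal, Complex.ofReal_mul, Complex.ofReal_ofNat]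
    linear_combination conj (ψ t) * ((Real.exp (-(1 * t ^ 2)) : ℝ) : ℂ) * 2 * inner ℂ (i v) z * h1
  · rw [← integral_neg]
    refine integral_congr_ae ?_
    filter_upwards [ae_pos, (memLp_smul_const (memLp_rpow_mul_gauss (b := s - 1 / 2) (by linarith)
      one_pos).ofReal (-z)).coeFn_toLp] with t ht hv
    have : (tracePair i hs0 z).snd t
        = ((t ^ (s - 1 / 2) * Real.exp (-(1 * t ^ 2)) : ℝ) : ℂ) • (-z) := hv
    rw [this, inner_smul_left, inner_smul_right, inner_neg_right]
    have h1 := hab (-(1 / 2)) ht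
    rw [show (-(1 / 2) + 1 / 2 : ℝ) = 0 by norm_num, Real.rpow_zero, ← sub_eq_add_neg] at h1
    simp only [map_mul, Complex.conj_ofReal, Complex.ofReal_mul]
    push_cast at h1 ⊢
    linear_combination -conj (deriv ψ t) * Complex.exp (-(1 * (t : ℂ) ^ 2)) * inner ℂ (i v) z * h1

end Neumann

section Neumann

variable {V H : Type*} [NormedAddCommGroup V] [InnerProductSpace ℂ V]
  [NormedAddCommGroup H] [InnerProductSpace ℂ H]

theorem inner_ofReal_smul_right (r : ℝ) (x y : H) : inner ℂ x (r • y) = (r : ℂ) * inner ℂ x y := by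
  rw [← Complex.coe_smul, inner_smul_right]

/-- The function `u` of the pair `(t ^ (1 / 2 - s) u, t ^ (1 / 2 - s) u')`. -/
def pairFst (s : ℝ) (k : PairSpace V H) (t : ℝ) : V := (t ^ (s - 1 / 2) : ℝ) • k.fst t

/-- The function `u'` of the pair `(t ^ (1 / 2 - s) u, t ^ (1 / 2 - s) u')`. -/
def pairSnd (s : ℝ) (k : PairSpace V H) (t : ℝ) : H := (t ^ (s - 1 / 2) : ℝ) • k.snd t

theorem rpow_smul_pairFst (s : ℝ) (k : PairSpace V H) {t : ℝ} (ht : 0 < t) :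
    (t ^ (1 / 2 - s) : ℝ) • pairFst s k t = k.fst t := by
  rw [pairFst, smul_smul, ← Real.rpow_add ht]
  simp

theorem rpow_smul_pairSnd (s : ℝ) (k : PairSpace V H) {t : ℝ} (ht : 0 < t) :
    (t ^ (1 / 2 - s) : ℝ) • pairSnd s k t = k.snd t := by
  rw [pairSnd, smul_smul, ← Real.rpow_add ht]
  simp

theorem memLp_pairFst (s : ℝ) (k : PairSpace V H) :
    MemLp (fun t : ℝ => (t ^ (1 / 2 - s) : ℝ) • pairFst s k t) 2 ν₊ := by
  refine (Lp.memLp k.fst).ae_eq ?_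
  filter_upwards [ae_pos] with t ht
  rw [rpow_smul_pairFst s k ht]

theorem memLp_pairSnd (s : ℝ) (k : PairSpace V H) :
    MemLp (fun t : ℝ => (t ^ (1 / 2 - s) : ℝ) • pairSnd s k t) 2 ν₊ := by
  refine (Lp.memLp k.snd).ae_eq ?_
  filter_upwards [ae_pos] with t ht
  rw [rpow_smul_pairSnd s k ht]

theorem memLp_rpow_smul_map {X Y : Type*} [NormedAddCommGroup X] [NormedSpace ℂ X]
    [NormedAddCommGroup Y] [NormedSpace ℂ Y] (L : X →L[ℂ] Y) {a : ℝ} {f : ℝ → X}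
    (hf : MemLp (fun t : ℝ => (t ^ a : ℝ) • f t) 2 ν₊) :
    MemLp (fun t : ℝ => (t ^ a : ℝ) • L (f t)) 2 ν₊ := by
  refine ((L.restrictScalars ℝ).comp_memLp' hf).ae_eq (Eventually.of_forall fun t => ?_)
  exact (L.restrictScalars ℝ).map_smul _ _

theorem memL1Loc_of_memLp {X : Type*} [NormedAddCommGroup X] [NormedSpace ℂ X] {a : ℝ}
    (ha : a < 1 / 2) {f : ℝ → X} (hf : MemLp (fun t : ℝ => (t ^ a : ℝ) • f t) 2 ν₊) :
    MemL1Loc f := by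
  obtain ⟨C, -, hC⟩ := exists_primitiveBound ha hf
  exact hC.memL1Loc

variable [CompleteSpace V] {i : V →L[ℂ] H} {s : ℝ}

theorem inner_testPair_pairMap (E : V →L[ℂ] V →L⋆[ℂ] ℂ) (k : PairSpace V H) {ψ : ℝ → ℂ}
    (hψ : IsTestFunction s ψ) (v : V) :
    inner ℂ (testPair i hψ v) (pairMap H (formMap E) k)
      = (∫ t in Ioi (0 : ℝ), conj (ψ t) * (((t ^ (1 - 2 * s) : ℝ) : ℂ) * E (pairFst s k t) v))
        + ∫ t in Ioi (0 : ℝ),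
          conj (deriv ψ t) * (((t ^ (1 - 2 * s) : ℝ) : ℂ) * inner ℂ (i v) (pairSnd s k t)) := by
  have hab {t : ℝ} (ht : 0 < t) : ((t ^ (1 / 2 - s) : ℝ) : ℂ) * ((t ^ (1 / 2 - s) : ℝ) : ℂ)
      = ((t ^ (1 - 2 * s) : ℝ) : ℂ) := by
    rw [← Complex.ofReal_mul, ← Real.rpow_add ht]
    congr 2
    ring
  rw [testPair, inner_mkPair]
  congr 1
  · refine integral_congr_ae ?_
    filter_upwards [ae_pos, pairMap_fst (H := H) (formMap E) k] with t ht hv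
    have hE : E (k.fst t) v = ((t ^ (1 / 2 - s) : ℝ) : ℂ) * E (pairFst s k t) v := by
      rw [← rpow_smul_pairFst s k ht, ← Complex.coe_smul, map_smul]
      rfl
    rw [hv, inner_smul_left, inner_formMap, hE, ← hab ht]
    simp only [map_mul, Complex.conj_ofReal]
    ring
  · refine integral_congr_ae ?_
    filter_upwards [ae_pos] with t ht
    rw [pairMap_snd, ← rpow_smul_pairSnd s k ht, inner_smul_left, inner_ofReal_smul_right,
      ← hab ht]
    simp only [map_mul, Complex.conj_ofReal]
    ring

variable [CompleteSpace H]

theorem inner_weakDerivPair (hs0 : 0 < s) (φ : {φ : ℝ → ℂ // ContDiff ℝ ∞ φ ∧ HasCompactSupport φ ∧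
    tsupport φ ⊆ Ioi (0 : ℝ)}) (h : H) (k : PairSpace V H) :
    inner ℂ (weakDerivPair i s φ h) k = inner ℂ h
      ((∫ t in Ioi (0 : ℝ), deriv φ.1 t • i (pairFst s k t)) +
        ∫ t in Ioi (0 : ℝ), φ.1 t • pairSnd s k t) := by
  obtain ⟨φ, hφ, hφc, hφs⟩ := φ
  have i1 : Integrable (fun t => deriv φ t • i (pairFst s k t)) ν₊ :=
    (MemL1Loc.integrable_smul (memL1Loc_of_memLp (by linarith)
      (memLp_rpow_smul_map i (memLp_pairFst s k))) (hφ.continuous_deriv (by simp)) hφc.deriv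
      (tsupport_deriv_subset'.trans hφs)).integrableOn
  have i2 : Integrable (fun t => φ t • pairSnd s k t) ν₊ :=
    (MemL1Loc.integrable_smul (memL1Loc_of_memLp (by linarith) (memLp_pairSnd s k))
      hφ.continuous hφc hφs).integrableOn
  have hi (r : ℝ) (y : V) : i (r • y) = r • i y := (i.restrictScalars ℝ).map_smul r y
  rw [inner_add_right, ← integral_inner i1, ← integral_inner i2, weakDerivPair, inner_mkPair]
  congr 1
  · congr 1
    ext t
    rw [inner_smul_left, inner_smul_right, ContinuousLinearMap.adjoint_inner_left, pairFst, hi,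
      inner_ofReal_smul_right]
    simp
    ring
  · congr 1
    ext t
    rw [inner_smul_left, inner_smul_right, pairSnd, inner_ofReal_smul_right]
    simp
    ring

/-- The second function of a pair in the Sobolev space is the weak derivative of the first one. -/
theorem isWeakDeriv_of_mem (hs0 : 0 < s) {k : PairSpace V H} (hk : k ∈ sobolevSubmodule i s) :
    IsWeakDeriv (fun t => i (pairFst s k t)) (pairSnd s k) := by
  refine ⟨memL1Loc_of_memLp (by linarith) (memLp_rpow_smul_map i (memLp_pairFst s k)),
    memL1Loc_of_memLp (by linarith) (memLp_pairSnd s k), fun φ hφ hφc hφs => ?_⟩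
  rw [neg_eq_iff_add_eq_zero]
  refine ext_inner_left ℂ fun h => ?_
  rw [inner_zero_right, ← inner_weakDerivPair hs0 ⟨φ, hφ, hφc, hφs⟩ h k]
  exact mem_sobolevSubmodule_iff.1 hk _ h

/-- The functional represented by `tracePair` is an integral expression for `⟨u(0), z⟩`. -/
theorem inner_tracePair (hs0 : 0 < s) (k : PairSpace V H) (z : H) :
    inner ℂ (tracePair i hs0 z) k = inner ℂ z
      (-(∫ t in Ioi (0 : ℝ), (-(2 * 1) * (t * Real.exp (-(1 * t ^ 2)))) • i (pairFst s k t))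
        - ∫ t in Ioi (0 : ℝ), Real.exp (-(1 * t ^ 2)) • pairSnd s k t) := by
  have i1 : Integrable (fun t : ℝ => (t * Real.exp (-(1 * t ^ 2))) • i (pairFst s k t)) ν₊ := by
    simpa using integrable_gauss_smul (b := 1) (memLp_rpow_smul_map i (memLp_pairFst s k)) one_pos
      (by linarith)
  have i2 : Integrable (fun t : ℝ => Real.exp (-(1 * t ^ 2)) • pairSnd s k t) ν₊ := by
    simpa using integrable_gauss_smul (b := 0) (memLp_pairSnd s k) one_pos (by linarith)
  have hi (r : ℝ) (y : V) : i (r • y) = r • i y := (i.restrictScalars ℝ).map_smul r y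
  simp only [mul_smul (-(2 * 1) : ℝ)]
  rw [integral_smul, inner_sub_right, inner_neg_right, inner_ofReal_smul_right,
    ← integral_inner i1, ← integral_inner i2, tracePair, inner_mkPair, ← neg_mul,
    ← integral_const_mul]
  refine (congrArg₂ (· + ·) ?_ ?_).trans (sub_eq_add_neg _ _).symm
  · refine integral_congr_ae ?_
    filter_upwards [ae_pos] with t ht
    rw [inner_smul_left, inner_smul_left, RCLike.conj_ofReal, map_ofNat,
      ContinuousLinearMap.adjoint_inner_left, pairFst, hi,
      inner_ofReal_smul_right, inner_ofReal_smul_right,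
      show s + 1 / 2 = s - 1 / 2 + 1 by ring, Real.rpow_add_one ht.ne']
    simp
    ring
  · rw [← integral_neg]
    refine integral_congr_ae ?_
    filter_upwards [ae_pos] with t ht
    rw [inner_smul_left, RCLike.conj_ofReal, inner_neg_left, pairSnd, inner_ofReal_smul_right,
      inner_ofReal_smul_right]
    simp
    ring

end Neumann

/-! ### Harmonic functions -/

section Harmonic

variable {V H : Type*} [NormedAddCommGroup V] [InnerProductSpace ℂ V]
  [NormedAddCommGroup H] [InnerProductSpace ℂ H] [CompleteSpace H]
  {i : V →L[ℂ] H} {E : V →L[ℂ] V →L⋆[ℂ] ℂ} {μ s : ℝ} {u : ℝ → V} {p : ℝ → H} {x z : H}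

/-- Harmonic functions whose conormal derivative lies in `H` are solutions in the integrated
sense. -/
theorem IsHarmonic.isSolution (hs0 : 0 < s) (hs1 : s < 1) (h : IsHarmonic i E s u p)
    (hx : HasTrace i u x)
    (hz : HasTrace (gelfand i) (fun t : ℝ => (t ^ (1 - 2 * s) : ℝ) • p t) (-gelfand i z)) :
    IsSolution i (gelfand i) E s u p x z := by
  obtain ⟨hu, w', hw, hode⟩ := h
  have e : 1 - s - 1 / 2 = 1 / 2 - s := by ring
  have hm1 := memLp_mulHaar_iff.1 hu.memLp
  have hm2 := memLp_mulHaar_iff.1 hu.memLp_deriv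
  have hm3 := memLp_mulHaar_iff.1 hw.memLp_deriv
  rw [e] at hm1 hm2
  obtain ⟨C, -, hC⟩ := exists_primitiveBound (by linarith) hm2
  obtain ⟨D, -, hD⟩ := exists_primitiveBound (by linarith) hm3
  obtain ⟨x', hx'⟩ := hu.isWeakDeriv.exists_eq_primitive hC
  obtain ⟨y', hy'⟩ := hw.isWeakDeriv.exists_eq_primitive hD
  rw [hasTrace_iff hC hx'] at hx
  rw [hasTrace_iff hD hy'] at hz
  subst hx hz
  refine ⟨hm1, hm2, hx', ?_⟩
  have hw' : ∀ᵐ t ∂ν₊, w' t = (t ^ (1 - 2 * s) : ℝ) • E (u t) := by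
    filter_upwards [hode] with t ht
    rwa [neg_add_eq_zero] at ht
  filter_upwards [hy'] with t ht
  rw [ht]
  congr 1
  exact integral_congr_ae (ae_mono (Measure.restrict_mono Ioc_subset_Ioi_self le_rfl) hw')

variable [CompleteSpace V]

theorem isTestFunction_conj {φ : ℝ → ℂ} (hφ : IsTestFunction s φ) :
    IsTestFunction s fun t => conj (φ t) := by
  have hd : deriv (fun t => conj (φ t)) = fun t => conj (deriv φ t) := deriv.star' (f := φ)
  refine ⟨Complex.conjCLE.contDiff.comp hφ.contDiff, ?_, ?_, ?_, ?_⟩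
  · refine hφ.memLp.star.ae_eq (Eventually.of_forall fun t => ?_)
    simp
  · rw [hd]
    refine hφ.memLp_deriv.star.ae_eq (Eventually.of_forall fun t => ?_)
    simp
  · simp only [RCLike.norm_conj]
    exact hφ.bounded
  · simpa [hd] using hφ.bounded_deriv

/-- The Neumann problem with datum `z ∈ H` is solvable, and its solution does not vanish at `0`
unless `z = 0`. -/
theorem exists_isHarmonic (hd : DenseRange i) (hμ : 0 < μ)
    (hE : ∀ u : V, μ * ‖u‖ ^ 2 ≤ (E u u).re) (hs0 : 0 < s) (hs1 : s < 1) (z : H) :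
    ∃ (u : ℝ → V) (p : ℝ → H) (x : H), IsHarmonic i E s u p ∧ HasTrace i u x ∧
      HasTrace (gelfand i) (fun t : ℝ => (t ^ (1 - 2 * s) : ℝ) • p t) (-gelfand i z) ∧
      (x = 0 → z = 0) := by
  have : CompleteSpace (sobolevSubmodule i s) := by
    unfold sobolevSubmodule
    infer_instance
  have hcoer (k : PairSpace V H) := pairMap_coercive (H := H) (T := formMap E) (μ := μ)
    (fun v => by rw [inner_formMap]; exact hE v) k
  obtain ⟨k, hkW, hk⟩ := exists_mem_forall_inner_eq (pairMap H (formMap E)) (lt_min hμ one_pos)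
    hcoer (sobolevSubmodule i s) (tracePair i hs0 z)
  set u := pairFst s k with hu_def
  set p := pairSnd s k with hp_def
  have hu := memLp_pairFst s k
  have hp := memLp_pairSnd s k
  rw [← hu_def] at hu
  rw [← hp_def] at hp
  have hweak := isWeakDeriv_of_mem hs0 hkW
  rw [← hu_def, ← hp_def] at hweak
  -- The variational equation for test functions `ψ ⊗ v`.
  have htest (ψ : ℝ → ℂ) (hψ : IsTestFunction s ψ) (v : V) :
      (∫ t in Ioi (0 : ℝ), ψ t * (((t ^ (1 - 2 * s) : ℝ) : ℂ) * E (u t) v))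
        + ∫ t in Ioi (0 : ℝ), deriv ψ t * (((t ^ (1 - 2 * s) : ℝ) : ℂ) * inner ℂ (i v) (p t))
      = ψ 0 * inner ℂ (i v) z := by
    have h1 := hk _ (testPair_mem i (isTestFunction_conj hψ) v)
    have hd : deriv (fun t => conj (ψ t)) = fun t => conj (deriv ψ t) := deriv.star' (f := ψ)
    rw [inner_testPair_pairMap, inner_testPair_tracePair] at h1
    simpa only [hd, Complex.conj_conj] using h1
  set w : ℝ → H := fun t => (t ^ (1 - 2 * s) : ℝ) • p t with hw_def
  set f : ℝ → V →L⋆[ℂ] ℂ := fun t => (t ^ (1 - 2 * s) : ℝ) • E (u t) with hf_def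
  have hw : MemLp (fun t : ℝ => (t ^ (s - 1 / 2) : ℝ) • w t) 2 ν₊ := by
    refine hp.ae_eq ?_
    filter_upwards [ae_pos] with t ht
    rw [hw_def, smul_smul, ← Real.rpow_add ht]
    congr 2
    ring
  have hf : MemLp (fun t : ℝ => (t ^ (s - 1 / 2) : ℝ) • f t) 2 ν₊ := memLp_rpow_smul_form hu
  have hgw := memLp_rpow_smul_map (gelfand i) hw
  have hfv (t : ℝ) (v : V) : f t v = ((t ^ (1 - 2 * s) : ℝ) : ℂ) * E (u t) v := rfl
  have hwv (t : ℝ) (v : V) : gelfand i (w t) v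
      = ((t ^ (1 - 2 * s) : ℝ) : ℂ) * inner ℂ (i v) (p t) := by
    rw [gelfand_apply, hw_def, inner_ofReal_smul_right]
  -- Evaluation of integrals in the antidual.
  have heval (g : ℝ → V →L⋆[ℂ] ℂ) (hg : Integrable g ν₊) (v : V) :
      (∫ t in Ioi (0 : ℝ), g t) v = ∫ t in Ioi (0 : ℝ), g t v :=
    ((ContinuousLinearMap.apply' ℂ (starRingEnd ℂ) v).integral_comp_comm hg).symm
  have hweak2 : IsWeakDeriv (fun t => gelfand i (w t)) f := by
    have hl1 := memL1Loc_of_memLp (by linarith) hgw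
    have hl2 := memL1Loc_of_memLp (by linarith) hf
    refine ⟨hl1, hl2, fun φ hφ hφc hφs => ?_⟩
    have hφ1 : ContDiff ℝ 1 φ := hφ.of_le (by simp)
    have i1 := (MemL1Loc.integrable_smul hl1 (hφ1.continuous_deriv le_rfl) hφc.deriv
      (tsupport_deriv_subset'.trans hφs)).integrableOn (s := Ioi 0)
    have i2 := (MemL1Loc.integrable_smul hl2 hφ.continuous hφc hφs).integrableOn (s := Ioi 0)
    ext v
    have h1 := htest φ (isTestFunction_of_hasCompactSupport hφ1 hφc hφs) v
    have h0 : φ 0 = 0 := image_eq_zero_of_notMem_tsupport fun h => lt_irrefl (0 : ℝ) (hφs h)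
    rw [h0, zero_mul] at h1
    rw [neg_apply, heval _ i1, heval _ i2, neg_eq_iff_add_eq_zero, add_comm]
    simp only [smul_apply, smul_eq_mul, hfv, hwv]
    exact h1
  obtain ⟨C, -, hC⟩ := exists_primitiveBound (by linarith) hp
  obtain ⟨D, -, hD⟩ := exists_primitiveBound (by linarith) hf
  obtain ⟨x, hx⟩ := hweak.exists_eq_primitive hC
  obtain ⟨y, hy⟩ := hweak2.exists_eq_primitive hD
  have hg (b : ℝ) (hb : -1 < b) := integrable_rpow_mul_gauss (q := 1) hb one_pos
  have hI : Integrable (fun t : ℝ => -(2 * 1) * (t * Real.exp (-(1 * t ^ 2)))) ν₊ := by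
    simpa using (hg 1 (by norm_num)).const_mul (-(2 * 1))
  have hIγ (γ : ℝ) (hγ : -1 < γ + 1) : Integrable (fun t : ℝ => t ^ γ *
      ‖-(2 * 1) * (t * Real.exp (-(1 * t ^ 2)))‖) ν₊ := by
    refine ((hg (γ + 1) hγ).const_mul 2).congr ?_
    filter_upwards [ae_pos] with t ht
    rw [Real.rpow_add_one ht.ne', norm_mul, norm_neg, Real.norm_of_nonneg (by norm_num),
      Real.norm_of_nonneg (by positivity)]
    ring
  have hψ0 : ContinuousWithinAt (fun t : ℝ => Real.exp (-(1 * t ^ 2))) (Ici 0) 0 := by fun_prop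
  have hψt : Tendsto (fun t : ℝ => Real.exp (-(1 * t ^ 2))) atTop (𝓝 0) := by simp
  have hgauss := isTestFunction_gauss hs1
  have hderiv : deriv (fun t : ℝ => ((Real.exp (-(1 * t ^ 2)) : ℝ) : ℂ))
      = fun t : ℝ => ((-(2 * 1) * (t * Real.exp (-(1 * t ^ 2))) : ℝ) : ℂ) :=
    funext fun t => (hasDerivAt_ofReal_gauss t).deriv
  have hexp0 : Real.exp (-(1 * (0 : ℝ) ^ 2)) = 1 := by simp
  -- The conormal derivative is read off by testing against `e^{-t²} ⊗ v`.
  have hyz : y = -gelfand i z := by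
    have h1 := integral_deriv_smul_eq hψ0 (fun t _ => hasDerivAt_gauss 1 t) hψt hI
      (hIγ _ (by linarith)) hD hy
    rw [hexp0, one_smul] at h1
    have i1 : Integrable (fun t : ℝ => (-(2 * 1) * (t * Real.exp (-(1 * t ^ 2)))) •
        gelfand i (w t)) ν₊ := by
      have := (integrable_gauss_smul (b := 1) hgw one_pos (by linarith)).smul (-(2 * 1) : ℝ)
      refine this.congr (Eventually.of_forall fun t => ?_)
      simp only [Pi.smul_apply, Real.rpow_one]
      exact smul_smul _ _ _
    have i2 : Integrable (fun t : ℝ => Real.exp (-(1 * t ^ 2)) • f t) ν₊ := by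
      simpa using integrable_gauss_smul (b := 0) hf one_pos (by linarith)
    ext v
    have h2 := congrArg (fun g => g v) h1
    simp only [sub_apply, neg_apply] at h2
    rw [heval _ i1, heval _ i2] at h2
    have h3 := htest _ hgauss v
    rw [hderiv, hexp0, Complex.ofReal_one, one_mul] at h3
    have e1 (t : ℝ) : ((-(2 * 1) * (t * Real.exp (-(1 * t ^ 2)))) • gelfand i (w t)) v
        = ((-(2 * 1) * (t * Real.exp (-(1 * t ^ 2))) : ℝ) : ℂ)
          * (((t ^ (1 - 2 * s) : ℝ) : ℂ) * inner ℂ (i v) (p t)) := by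
      rw [← hwv]; rfl
    have e2 (t : ℝ) : (Real.exp (-(1 * t ^ 2)) • f t) v = ((Real.exp (-(1 * t ^ 2)) : ℝ) : ℂ)
          * (((t ^ (1 - 2 * s) : ℝ) : ℂ) * E (u t) v) := by
      rw [← hfv]; rfl
    simp only [e1, e2] at h2
    rw [neg_apply, gelfand_apply, ← h3, h2]
    ring
  refine ⟨u, p, x, ⟨⟨memL1Loc_of_memLp (by linarith) hu, hweak, ?_, ?_⟩, f,
    ⟨memL1Loc_of_memLp (by linarith) hw, hweak2, ?_, ?_⟩, ?_⟩, (hasTrace_iff hC hx).2 rfl,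
    (hasTrace_iff hD hy).2 hyz.symm, fun hx0 => ?_⟩
  · rw [memLp_mulHaar_iff]
    rwa [show 1 - s - 1 / 2 = 1 / 2 - s by ring]
  · rw [memLp_mulHaar_iff]
    rwa [show 1 - s - 1 / 2 = 1 / 2 - s by ring]
  · exact memLp_mulHaar_iff.2 hw
  · exact memLp_mulHaar_iff.2 hf
  · exact Eventually.of_forall fun t => neg_add_cancel _
  -- Testing with the solution itself bounds `‖k‖²` by a multiple of `Re ⟨u(0), z⟩`. Thus `u(0) = 0`
  -- gives `k = 0`, and then `z` is orthogonal to the dense image of `V`.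
  · have h1 := integral_deriv_smul_eq hψ0 (fun t _ => hasDerivAt_gauss 1 t) hψt hI
      (hIγ _ (by linarith)) hC hx
    rw [hx0, smul_zero, neg_zero, zero_sub] at h1
    have h2 : inner ℂ (tracePair i hs0 z) k = 0 := by
      rw [inner_tracePair, ← hu_def, ← hp_def, h1, neg_neg, sub_self, inner_zero_right]
    have h3 := hcoer k
    rw [hk k hkW, ← inner_conj_symm, h2] at h3
    have hk0 : k = 0 := by
      by_contra hne
      have h4 : 0 < min μ 1 * ‖k‖ ^ 2 :=
        mul_pos (lt_min hμ one_pos) (pow_pos (norm_pos_iff.2 hne) 2)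
      rw [map_zero, Complex.zero_re] at h3
      linarith
    refine hd.eq_zero_of_inner_right ℂ fun v => ?_
    have h5 := hk _ (testPair_mem i hgauss v)
    rw [hk0, map_zero, inner_zero_right, inner_testPair_tracePair, hexp0] at h5
    simpa using h5.symm

end Harmonic

end FracDtN

end


open FracDtN in
theorem theorem5p1 {V H : Type*}
    [NormedAddCommGroup V] [InnerProductSpace ℂ V] [CompleteSpace V]
    [NormedAddCommGroup H] [InnerProductSpace ℂ H] [CompleteSpace H]
    (i : V →L[ℂ] H) (hi : Function.Injective i) (hd : DenseRange i)
    (E : V →L[ℂ] V →L⋆[ℂ] ℂ)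
    (hE : ∃ μ : ℝ, 0 < μ ∧ ∀ u : V, μ * ‖u‖ ^ 2 ≤ (E u u).re)
    (s : ℝ) (hs0 : 0 < s) (hs1 : s < 1) :
    FracDtN.dtnPartGraph i E s =
      ((FracDtN.dtnConst s : ℂ) • FracDtN.fracPow (FracDtN.formOp i E) s).graph := by
  obtain ⟨μ, hμ, hE⟩ := hE
  have hc : 0 < dtnConst s := by
    have h1 := Real.Gamma_pos_of_pos hs0
    have h2 : 0 < Real.Gamma (1 - s) := Real.Gamma_pos_of_pos (by linarith)
    unfold dtnConst
    positivity
  have hc' : (dtnConst s : ℂ) ≠ 0 := by exact_mod_cast hc.ne'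
  set N := negFracPow (formOp i E) s with hN
  -- Injectivity of `A ^ (-s)`, without which the inverse partial map would be a default value.
  have hinj : LinearMap.ker ((N : H →ₗ[ℂ] H).toPMap ⊤).toFun = ⊥ := by
    rw [LinearMap.ker_eq_bot']
    rintro ⟨z, hz⟩ h0
    obtain ⟨u, p, x, hu, hx, hw, hxz⟩ := exists_isHarmonic hd hμ hE hs0 hs1 z
    have h1 := (hu.isSolution hs0 hs1 hx hw).negFracPow_eq hi hd hμ hE hs0 hs1
    have h2 : N z = 0 := h0
    rw [← hN, h2, eq_comm, smul_eq_zero] at h1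
    exact Subtype.ext (hxz (h1.resolve_left hc.ne'))
  have hgraph (x y : H) : (x, y) ∈ (((dtnConst s : ℂ) • fracPow (formOp i E) s).graph)
      ↔ ∃ y', N y' = x ∧ (dtnConst s : ℂ) • y' = y := by
    rw [LinearPMap.smul_graph, fracPow, LinearPMap.inverse_graph hinj]
    simp only [Submodule.mem_map, Prod.exists, LinearPMap.mem_graph_iff]
    constructor
    · rintro ⟨a, b, ⟨a', b', ⟨c, rfl, rfl⟩, h1⟩, h2⟩
      simp only [LinearEquiv.coe_coe, LinearEquiv.prodComm_apply, Prod.swap_prod_mk,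
        Prod.mk.injEq] at h1
      obtain ⟨rfl, rfl⟩ := h1
      simp only [LinearMap.prodMap_apply, Prod.mk.injEq] at h2
      exact ⟨c, h2.1, h2.2⟩
    · rintro ⟨y', rfl, rfl⟩
      exact ⟨N y', y', ⟨y', N y', ⟨⟨y', trivial⟩, rfl, rfl⟩, rfl⟩, rfl⟩
  ext ⟨x, y⟩
  rw [SetLike.mem_coe, hgraph]
  constructor
  · rintro ⟨-, u, p, hu, hx, hw⟩
    have h := (hu.isSolution hs0 hs1 hx hw).negFracPow_eq hi hd hμ hE hs0 hs1
    refine ⟨(dtnConst s : ℂ)⁻¹ • y, ?_, smul_inv_smul₀ hc' y⟩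
    rw [map_smul, hN, h, ← Complex.coe_smul, inv_smul_smul₀ hc']
  · rintro ⟨y', rfl, rfl⟩
    refine ⟨negFracPow_mem_complexInterp hi hd hμ hE hs0 hs1 y', ?_⟩
    obtain ⟨u, p, x, hu, hx, hw, -⟩ := exists_isHarmonic hd hμ hE hs0 hs1 ((dtnConst s : ℂ) • y')
    have h := (hu.isSolution hs0 hs1 hx hw).negFracPow_eq hi hd hμ hE hs0 hs1
    rw [map_smul, ← Complex.coe_smul] at h
    have hxe : N y' = x := smul_right_injective H hc' h
    refine ⟨u, p, hu, ?_, hw⟩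
    rw [hxe]
    exact hx
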